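/- For an integer $n\ge 2$ and real $\gamma$, let $$K_\gamma(x,t)=\frac{1}{(2\pi)^n}\int_{\mathbb{R}^n}e^{i(x\cdot\xi+t|\xi|)}\,\frac{d\xi}{|\xi|^{\gamma}},\qquad x\in\mathbb{R}^n,\ t\in\mathbb{R},$$ where the integral is understood as the improper integral $\lim_{R\to\infty}\int_{|\xi|\le R}$. (i) Let $n\ge 4$ and $\frac{n+1}{2}<\gamma<n-1$. Then there is a constant $C>0$, depending only on $n$ and $\gamma$, such that for all $x\in\mathbb{R}^n\setminus\{0\}$ and $t\in\mathbb{R}$ the integral defining $K_\gamma(x,t)$ converges and $$|K_\gamma(x,t)|\le C\begin{cases}|x|^{-(n-\gamma)}&\text{if }|x|\ge |t|/2,\\ |t|^{-1}|x|^{-(n-1-\gamma)}&\text{if }|x|\le |t|/2.\end{cases}$$ (ii) Let either $n\ge 3$ and $\frac{n-1}{2}<\gamma<\frac{n+1}{2}$, or $n=2$ and $\frac12<\gamma<1$. Then there is a constant $C>0$, depending only on $n$ and $\gamma$, such that for all $x\in\mathbb{R}^n\setminus\{0\}$ and $t\in\mathbb{R}$ with $|x|\ne|t|$ the integral defining $K_\gamma(x,t)$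 converges and $$|K_\gamma(x,t)|\le C\begin{cases}|x|^{-\frac{n-1}{2}}\,\big||x|-|t|\big|^{-\left(\frac{n+1}{2}-\gamma\right)}&\text{if }|x|\ge |t|/2,\\ |t|^{-1}|x|^{-(n-1-\gamma)}&\text{if }|x|\le |t|/2.\end{cases}$$ -/

import Mathlib

open MeasureTheory Filter Topology

/-- The oscillatory integral `(2π)⁻ⁿ ∫ e^{i(x·ξ + t|ξ|)} |ξ|^{-γ} dξ` truncated to the ball `|ξ| ≤ R`.
For `γ < n` the integrand is absolutely integrable on every such ball. -/
noncomputable def truncatedWaveKernel (n : ℕ) (γ : ℝ) (R : ℝ)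
    (x : EuclideanSpace ℝ (Fin n)) (t : ℝ) : ℂ :=
  ((2 * (Real.pi : ℂ)) ^ n)⁻¹ *
    ∫ ξ in Metric.closedBall (0 : EuclideanSpace ℝ (Fin n)) R,
      Complex.exp (Complex.I * ((inner ℝ x ξ + t * ‖ξ‖ : ℝ) : ℂ)) * ((‖ξ‖ ^ (-γ) : ℝ) : ℂ)

/-- The kernel `K_γ(x,t) = (2π)⁻ⁿ ∫ e^{i(x·ξ + t|ξ|)} |ξ|^{-γ} dξ`. The integral over the whole space
is not absolutely convergent; it is the improper integral in the radial variable `ω = |ξ|`, that is,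
the limit of the integrals over `|ξ| ≤ R` as `R → ∞`. The value is meaningful where that limit
exists. -/
noncomputable def waveKernel (n : ℕ) (γ : ℝ) (x : EuclideanSpace ℝ (Fin n)) (t : ℝ) : ℂ :=
  limUnder atTop (fun R : ℝ => truncatedWaveKernel n γ R x t)

/-! In polar coordinates the kernel becomes one-dimensional. If `Φ` is the radial profile of the
Fourier transform of surface measure on the unit sphere, then after rescaling `s = |x| r`, up to the
factor `(2π)⁻ⁿ`, the kernel is `|x|^(-(n-γ))` times the improper integral of `e^{ils} s^α Φ(s)` over
`(0, ∞)`, with `l = t/|x|` and `α = n-1-γ > 0`.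

No Bessel asymptotics are used. `Φ` solves the radial Helmholtz equation (`exists_radial_profile`),
so with `m = (n-1)/2` the function `v = s^m Φ` solves `v'' + (1 - k/s²) v = 0`, `k = m(m-1)`. An
energy argument bounds `v` and `v'` on `[1, ∞)`, and `s^α Φ = s^(-a) v` with `a = γ - m > 0`.

If `a > 1`, the tails converge absolutely, uniformly in `l`. If `0 < a < 1`, write `v` and `v'` as
combinations of `e^{±is}` with amplitudes whose derivatives are `O(s⁻²)`. The phases become `(l ±
1)s`, and the tails are bounded by a constant times `1 + ||l|-1|^(a-1)`
(`exists_tendsto_of_inverse_square_potential`). This produces the singularity on the cone `|x| =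
|t|`.

For `|x| ≤ |t|/2` one integration by parts over `(0, ∞)` gains `1/|l| = |x|/|t|`; the new integrand
is controlled by the tails of `v` and `v'` (`exists_tendsto_of_tails`). -/

/-! ### Fourier transform of the sphere and its radial equation -/

section Sphere

open Metric Set
open scoped Pointwise

variable {E : Type*} [NormedAddCommGroup E] [InnerProductSpace ℝ E] [FiniteDimensional ℝ E]
  [MeasurableSpace E] [BorelSpace E]

/-- The action of a linear isometry on the unit sphere. -/
def LinearIsometryEquiv.onSphere (A : E ≃ₗᵢ[ℝ] E) (θ : sphere (0 : E) 1) : sphere (0 : E) 1 :=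
  ⟨A θ, by simp⟩

theorem LinearIsometryEquiv.continuous_onSphere {E : Type*} [NormedAddCommGroup E]
    [InnerProductSpace ℝ E] (A : E ≃ₗᵢ[ℝ] E) : Continuous A.onSphere :=
  Continuous.subtype_mk (A.continuous.comp continuous_subtype_val) _

/-- Surface measure is a multiple of the volume of the cone over a set, and a linear isometry
preserves volume and maps cones to cones. -/
theorem LinearIsometryEquiv.measurePreserving_onSphere (A : E ≃ₗᵢ[ℝ] E) :
    MeasurePreserving A.onSphere (volume : Measure E).toSphere (volume : Measure E).toSphere := by
  refine ⟨A.continuous_onSphere.measurable, ?_⟩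
  ext s hs
  rw [Measure.map_apply A.continuous_onSphere.measurable hs, Measure.toSphere_apply' _ hs,
    Measure.toSphere_apply' _ (A.continuous_onSphere.measurable hs)]
  congr 1
  rw [← A.measurePreserving.measure_preimage_emb A.toHomeomorph.measurableEmbedding
    (Ioo (0 : ℝ) 1 • (Subtype.val '' s))]
  congr 1
  ext y
  simp only [Set.mem_smul, mem_image, mem_preimage]
  constructor
  · rintro ⟨r, hr, _, ⟨θ, hθ, rfl⟩, rfl⟩
    exact ⟨r, hr, A θ, ⟨A.onSphere θ, hθ, rfl⟩, (A.map_smul r (θ : E)).symm⟩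
  · rintro ⟨r, hr, _, ⟨θ, hθ, rfl⟩, h⟩
    refine ⟨r, hr, A.symm θ, ⟨A.symm.onSphere θ, ?_, rfl⟩, ?_⟩
    · have : A.onSphere (A.symm.onSphere θ) = θ := by
        apply Subtype.ext; simp [onSphere]
      rwa [this]
    · rw [← map_smul, h]
      exact A.symm_apply_apply y

/-- The Fourier transform of the surface measure of the unit sphere. -/
noncomputable def sphereTransform (x : E) : ℂ :=
  ∫ θ : sphere (0 : E) 1, Complex.exp (Complex.I * ((inner ℝ x (θ : E) : ℝ) : ℂ))
    ∂(volume : Measure E).toSphere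

theorem sphereTransform_map (A : E ≃ₗᵢ[ℝ] E) (x : E) :
    sphereTransform (A x) = sphereTransform x := by
  have hemb : MeasurableEmbedding A.onSphere :=
    A.continuous_onSphere.measurableEmbedding fun θ η h => by
      apply Subtype.ext
      have := congrArg Subtype.val h
      exact A.injective this
  unfold sphereTransform
  rw [← A.measurePreserving_onSphere.integral_comp hemb]
  simp [LinearIsometryEquiv.onSphere]

/-- The reflection in the hyperplane orthogonal to `x - y` takes `x` to `y` when the norms agree. -/
theorem sphereTransform_eq_of_norm_eq {x y : E} (h : ‖x‖ = ‖y‖) :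
    sphereTransform x = sphereTransform y := by
  rw [← sphereTransform_map (Submodule.reflection (ℝ ∙ (x - y))ᗮ) x, Submodule.reflection_sub h]

/-- Differentiation under the integral sign in an oscillatory integral. -/
theorem hasDerivAt_integral_exp_mul {α : Type*} [TopologicalSpace α] [CompactSpace α]
    [MeasurableSpace α] [OpensMeasurableSpace α] {μ : Measure α} [IsFiniteMeasure μ]
    {c : α → ℂ} {g : α → ℝ} (hc : Continuous c) (hg : Continuous g) (s : ℝ) :
    HasDerivAt (fun h : ℝ => ∫ θ, c θ * Complex.exp (Complex.I * ((h * g θ : ℝ) : ℂ)) ∂μ)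
      (∫ θ, c θ * (Complex.I * g θ) * Complex.exp (Complex.I * ((s * g θ : ℝ) : ℂ)) ∂μ) s := by
  have hint : ∀ {f : α → ℂ}, Continuous f → Integrable f μ := fun hf =>
    hf.integrable_of_hasCompactSupport (HasCompactSupport.of_compactSpace _)
  refine (hasDerivAt_integral_of_dominated_loc_of_deriv_le (s := univ) (bound := fun θ => ‖c θ * (Complex.I * g θ)‖) univ_mem
    (Eventually.of_forall fun x => (hint (by fun_prop)).aestronglyMeasurable) (hint (by fun_prop))
    (F' := fun s θ => c θ * (Complex.I * g θ) * Complex.exp (Complex.I * ((s * g θ : ℝ) : ℂ)))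
    (hint (by fun_prop)).aestronglyMeasurable
    (Eventually.of_forall fun θ x _ => ?_) (hint (by fun_prop)).norm
    (Eventually.of_forall fun θ x _ => ?_)).2
  · rw [norm_mul, Complex.norm_exp_I_mul_ofReal, mul_one]
  · have h1 : HasDerivAt (fun h : ℝ => Complex.I * ((h * g θ : ℝ) : ℂ)) (Complex.I * g θ) x := by
      have := ((hasDerivAt_id x).mul_const (g θ)).ofReal_comp.const_mul Complex.I
      simpa using this
    exact ((h1.cexp).const_mul (c θ)).congr_deriv (by ring)

/-- The radial profile of `sphereTransform` and its first derivatives satisfy the radial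
Helmholtz equation. -/
theorem exists_radial_profile (hE : 0 < Module.finrank ℝ E) :
    ∃ Φ Φ₁ Φ₂ : ℝ → ℂ, (∀ s, HasDerivAt Φ (Φ₁ s) s) ∧ (∀ s, HasDerivAt Φ₁ (Φ₂ s) s) ∧
      (∀ s, 0 < s → s * Φ₂ s + ((Module.finrank ℝ E : ℂ) - 1) * Φ₁ s + s * Φ s = 0) ∧
      ∀ x : E, sphereTransform x = Φ ‖x‖ := by
  set N := Module.finrank ℝ E with hN
  set b : OrthonormalBasis (Fin N) ℝ E := stdOrthonormalBasis ℝ E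
  set i0 : Fin N := ⟨0, hE⟩
  let σ : Measure (sphere (0 : E) 1) := (volume : Measure E).toSphere
  let g : Fin N → sphere (0 : E) 1 → ℝ := fun i θ => inner ℝ (b i) (θ : E)
  have hg : ∀ i, Continuous (g i) := fun i => by fun_prop
  have hgsum : ∀ θ, ∑ i, (g i θ : ℂ) ^ 2 = 1 := fun θ => by
    have h := b.sum_sq_inner_right (θ : E)
    have h1 : ‖(θ : E)‖ = 1 := by simp
    rw [h1] at h
    have : ∑ i, (g i θ) ^ 2 = (1:ℝ) := by simpa using h
    exact_mod_cast this
  let e : ℝ → sphere (0 : E) 1 → ℂ := fun s θ => Complex.exp (Complex.I * ((s * g i0 θ : ℝ) : ℂ))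
  have he : ∀ s, Continuous (e s) := fun s => by
    have := hg i0
    fun_prop
  have hint : ∀ {f : sphere (0 : E) 1 → ℂ}, Continuous f → Integrable f σ := fun hf =>
    hf.integrable_of_hasCompactSupport (HasCompactSupport.of_compactSpace _)
  let Φ : ℝ → ℂ := fun s => ∫ θ, 1 * e s θ ∂σ
  let Φ₁ : ℝ → ℂ := fun s => ∫ θ, 1 * (Complex.I * g i0 θ) * e s θ ∂σ
  let Φ₂ : ℝ → ℂ := fun s => ∫ θ, 1 * (Complex.I * g i0 θ) * (Complex.I * g i0 θ) * e s θ ∂σ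
  have hΦ : ∀ s, HasDerivAt Φ (Φ₁ s) s := fun s =>
    hasDerivAt_integral_exp_mul continuous_const (hg i0) s
  have hΦ₁ : ∀ s, HasDerivAt Φ₁ (Φ₂ s) s := fun s =>
    hasDerivAt_integral_exp_mul (by have := hg i0; fun_prop) (hg i0) s
  have hrad : ∀ x : E, sphereTransform x = Φ ‖x‖ := fun x => by
    have : ‖x‖ = ‖‖x‖ • b i0‖ := by simp [norm_smul]
    rw [sphereTransform_eq_of_norm_eq this]
    simp only [sphereTransform, Φ, e, one_mul, real_inner_smul_left, g, σ]
  -- By radiality the transform at `s • b i0 + h • b i` is `Φ (√(s² + h²))`. Differentiating twice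
  -- in `h` at `0` gives `-∫ θᵢ² e = Φ₁ s / s`. Summing such moments over all coordinates, with `∑
  -- θᵢ² = 1`, yields the equation.
  have hmom : ∀ s : ℝ, 0 < s → ∀ i, i ≠ i0 →
      s * ∫ θ, (g i θ : ℂ) ^ 2 * e s θ ∂σ = - Φ₁ s := by
    intro s hs i hi
    have hA : ∀ h : ℝ, ∫ θ, e s θ * Complex.exp (Complex.I * ((h * g i θ : ℝ) : ℂ)) ∂σ
        = Φ (Real.sqrt (s ^ 2 + h ^ 2)) := by
      intro h
      have hn : ‖s • b i0 + h • b i‖ = Real.sqrt (s ^ 2 + h ^ 2) := by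
        rw [eq_comm, Real.sqrt_eq_iff_mul_self_eq (by positivity) (norm_nonneg _),
          norm_add_mul_self_real]
        have : inner ℝ (b i0) (b i) = (0:ℝ) := b.orthonormal.2 hi.symm
        simp only [real_inner_smul_left, real_inner_smul_right, this, norm_smul,
          b.norm_eq_one, Real.norm_eq_abs]
        simp
        ring
      rw [← hn, ← hrad]
      refine integral_congr_ae (Eventually.of_forall fun θ => ?_)
      simp only [e, ← Complex.exp_add, ← mul_add, ← Complex.ofReal_add, g, inner_add_left,
        real_inner_smul_left]
    have hA1 : ∀ h : ℝ, ∫ θ, e s θ * (Complex.I * g i θ)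
          * Complex.exp (Complex.I * ((h * g i θ : ℝ) : ℂ)) ∂σ
        = (h / Real.sqrt (s ^ 2 + h ^ 2) : ℝ) * Φ₁ (Real.sqrt (s ^ 2 + h ^ 2)) := by
      intro h
      have h1 := hasDerivAt_integral_exp_mul (μ := σ) (he s) (hg i) h
      simp only [hA] at h1
      have h2 : HasDerivAt (fun h : ℝ => Real.sqrt (s ^ 2 + h ^ 2))
          (h / Real.sqrt (s ^ 2 + h ^ 2)) h := by
        have h3 : HasDerivAt (fun h : ℝ => s ^ 2 + h ^ 2) (2 * h) h := by
          simpa using ((hasDerivAt_id h).pow 2).const_add (s ^ 2)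
        exact (h3.sqrt (by positivity)).congr_deriv (mul_div_mul_left _ _ two_ne_zero)
      have h4 := (hΦ (Real.sqrt (s ^ 2 + h ^ 2))).scomp h h2
      rw [h1.unique h4, Complex.real_smul]
    have h1 := hasDerivAt_integral_exp_mul (μ := σ) (c := fun θ => e s θ * (Complex.I * g i θ))
      (by have := hg i; have := he s; fun_prop) (hg i) 0
    simp only [hA1] at h1
    have h2 : HasDerivAt (fun h : ℝ => h / Real.sqrt (s ^ 2 + h ^ 2)) (1 / s) 0 := by
      have h3 : HasDerivAt (fun h : ℝ => s ^ 2 + h ^ 2) (2 * 0) 0 := by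
        simpa using ((hasDerivAt_id (0:ℝ)).pow 2).const_add (s ^ 2)
      have h4 := h3.sqrt (by positivity)
      refine ((hasDerivAt_id (0:ℝ)).div h4 (by positivity)).congr_deriv ?_
      have : Real.sqrt (s ^ 2) = s := Real.sqrt_sq hs.le
      simp only [id, mul_zero, zero_div, sub_zero, one_mul, ne_eq, OfNat.ofNat_ne_zero,
        not_false_eq_true, zero_pow, add_zero, this]
      field_simp
    -- `√(s² + h²)` is stationary at `h = 0`, so only the factor `h / √(s² + h²)` contributes to the
    -- second derivative.
    have h3 : HasDerivAt (fun h : ℝ => Φ₁ (Real.sqrt (s ^ 2 + h ^ 2))) ((0:ℝ) • Φ₂ s) 0 := by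
      have h3 : HasDerivAt (fun h : ℝ => s ^ 2 + h ^ 2) (2 * 0) 0 := by
        simpa using ((hasDerivAt_id (0:ℝ)).pow 2).const_add (s ^ 2)
      have h4 := h3.sqrt (by positivity)
      have h5 : Real.sqrt (s ^ 2 + 0 ^ 2) = s := by simp [Real.sqrt_sq hs.le]
      have h6 := hΦ₁ (Real.sqrt (s ^ 2 + 0 ^ 2))
      have := h6.scomp 0 h4
      rw [h5, mul_zero, zero_div] at this
      exact this
    have h4 := h1.unique (h2.ofReal_comp.mul h3)
    have h5 : Real.sqrt (s ^ 2 + 0 ^ 2) = s := by simp [Real.sqrt_sq hs.le]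
    rw [h5] at h4
    have h6 : ∫ θ, (g i θ : ℂ) ^ 2 * e s θ ∂σ = -((1 / s : ℝ) * Φ₁ s) := by
      rw [zero_smul, mul_zero, add_zero] at h4
      rw [← h4, ← integral_neg]
      refine integral_congr_ae (Eventually.of_forall fun θ => ?_)
      simp only [zero_mul, Complex.ofReal_zero, mul_zero, Complex.exp_zero, mul_one]
      linear_combination (g i θ : ℂ) ^ 2 * e s θ * Complex.I_sq
    rw [h6]
    have : (s : ℂ) ≠ 0 := by exact_mod_cast hs.ne'
    push_cast
    field_simp
  refine ⟨Φ, Φ₁, Φ₂, hΦ, hΦ₁, fun s hs => ?_, hrad⟩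
  have hΦ₂ : Φ₂ s = - ∫ θ, (g i0 θ : ℂ) ^ 2 * e s θ ∂σ := by
    rw [← integral_neg]
    refine integral_congr_ae (Eventually.of_forall fun θ => ?_)
    simp only
    linear_combination (g i0 θ : ℂ) ^ 2 * e s θ * Complex.I_sq
  have hsum : ∑ i, ∫ θ, (g i θ : ℂ) ^ 2 * e s θ ∂σ = Φ s := by
    rw [← integral_finsetSum _ fun i _ => hint (by have := hg i; have := he s; fun_prop)]
    simp only [← Finset.sum_mul, hgsum, Φ]
  rw [← Finset.add_sum_erase _ _ (Finset.mem_univ i0)] at hsum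
  have h7 : s * ∑ i ∈ Finset.univ.erase i0, ∫ θ, (g i θ : ℂ) ^ 2 * e s θ ∂σ
      = - ((N : ℂ) - 1) * Φ₁ s := by
    rw [Finset.mul_sum, Finset.sum_congr rfl fun i hi => hmom s hs i (Finset.ne_of_mem_erase hi)]
    rw [Finset.sum_const, Finset.card_erase_of_mem (Finset.mem_univ _), Finset.card_fin,
      nsmul_eq_mul, Nat.cast_sub hE]
    push_cast; ring
  rw [hΦ₂, ← hsum]
  linear_combination h7

end Sphere

/-! ### Polar coordinates and reduction to one dimension -/

section Polar

open Metric Set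

variable {E : Type*} [NormedAddCommGroup E] [InnerProductSpace ℝ E] [FiniteDimensional ℝ E]
  [MeasurableSpace E] [BorelSpace E]

theorem integrable_volumeIoiPow_iff {F : Type*} [NormedAddCommGroup F] [NormedSpace ℝ F]
    (n : ℕ) (f : ℝ → F) :
    Integrable (fun r : Ioi (0 : ℝ) => f r) (Measure.volumeIoiPow n) ↔
      IntegrableOn (fun r : ℝ => r ^ n • f r) (Ioi 0) := by
  rw [integrableOn_iff_comap_subtypeVal measurableSet_Ioi, Measure.volumeIoiPow,
    integrable_withDensity_iff_integrable_smul' (by fun_prop) (by simp)]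
  refine integrable_congr (.of_forall ?_)
  rintro ⟨r, hr : 0 < r⟩
  simp (disch := positivity) [ENNReal.toReal_ofReal]

theorem integral_volumeIoiPow {F : Type*} [NormedAddCommGroup F] [NormedSpace ℝ F]
    (n : ℕ) (f : ℝ → F) :
    ∫ r : Ioi (0 : ℝ), f r ∂(Measure.volumeIoiPow n) = ∫ r in Ioi (0 : ℝ), r ^ n • f r := by
  simp only [Measure.volumeIoiPow, ENNReal.ofReal]
  rw [integral_withDensity_eq_integral_smul,
    integral_subtype_comap measurableSet_Ioi fun a ↦ Real.toNNReal (a ^ n) • f a,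
    setIntegral_congr_fun measurableSet_Ioi fun x hx ↦ ?_]
  · rw [NNReal.smul_def, Real.coe_toNNReal _ (pow_nonneg (le_of_lt hx) _)]
  · exact (measurable_subtype_coe.pow_const _).real_toNNReal

/-- The Fourier transform of a radial function in polar coordinates. -/
theorem integral_exp_mul_radial [Nontrivial E] (x : E) (f : ℝ → ℂ)
    (hf : IntegrableOn (fun r : ℝ => r ^ (Module.finrank ℝ E - 1) • f r) (Ioi 0)) :
    ∫ ξ : E, Complex.exp (Complex.I * ((inner ℝ x ξ : ℝ) : ℂ)) * f ‖ξ‖ =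
      ∫ r in Ioi (0 : ℝ), r ^ (Module.finrank ℝ E - 1) • (f r * sphereTransform (r • x)) := by
  set N := Module.finrank ℝ E
  let G : sphere (0 : E) 1 × Ioi (0 : ℝ) → ℂ := fun z =>
    Complex.exp (Complex.I * ((inner ℝ x ((z.2 : ℝ) • (z.1 : E)) : ℝ) : ℂ)) * f z.2
  -- The phase has modulus one and the sphere has finite measure, so radial integrability is enough
  -- for Fubini.
  have hG : Integrable G ((volume : Measure E).toSphere.prod (Measure.volumeIoiPow (N - 1))) := by
    refine Integrable.bdd_mul (c := 1) (((integrable_volumeIoiPow_iff _ f).2 hf).comp_snd _) ?_ ?_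
    · refine Continuous.aestronglyMeasurable ?_
      fun_prop
    · refine .of_forall fun z => ?_
      rw [Complex.norm_exp_I_mul_ofReal]
  calc
    _ = ∫ ξ : ({(0)}ᶜ : Set E), Complex.exp (Complex.I * ((inner ℝ x (ξ : E) : ℝ) : ℂ)) * f ‖(ξ : E)‖
          ∂((volume : Measure E).comap (↑)) := by
      rw [integral_subtype_comap (measurableSet_singleton _).compl
        fun ξ : E ↦ Complex.exp (Complex.I * ((inner ℝ x ξ : ℝ) : ℂ)) * f ‖ξ‖,
        restrict_compl_singleton]
    _ = ∫ z, G z ∂(volume : Measure E).toSphere.prod (Measure.volumeIoiPow (N - 1)) := by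
      rw [← (volume : Measure E).measurePreserving_homeomorphUnitSphereProd.integral_comp
        (Homeomorph.measurableEmbedding _) G]
      refine integral_congr_ae (.of_forall fun ξ => ?_)
      have h0 : ‖(ξ : E)‖ ≠ 0 := norm_ne_zero_iff.2 ξ.2
      simp [G, smul_smul, h0]
    _ = ∫ r : Ioi (0 : ℝ), f r * sphereTransform ((r : ℝ) • x) ∂(Measure.volumeIoiPow (N - 1)) := by
      rw [integral_prod_symm _ hG]
      refine integral_congr_ae (.of_forall fun r => ?_)
      simp only [G, sphereTransform]
      rw [integral_mul_const, mul_comm]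
      simp only [real_inner_smul_left, real_inner_smul_right]
    _ = _ := integral_volumeIoiPow _ fun r => f r * sphereTransform (r • x)

end Polar

/-- The truncated kernel as a one-dimensional oscillatory integral. -/
theorem truncatedWaveKernel_eq {n : ℕ} (hn : 2 ≤ n) {γ : ℝ} (hγ : γ < n - 1) {Φ : ℝ → ℂ}
    (hΦ : ∀ x : EuclideanSpace ℝ (Fin n), sphereTransform x = Φ ‖x‖)
    (x : EuclideanSpace ℝ (Fin n)) (hx : x ≠ 0) (t : ℝ) {R : ℝ} (hR : 0 ≤ R) :
    truncatedWaveKernel n γ R x t = ((2 * (Real.pi : ℂ)) ^ n)⁻¹ *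
      ((‖x‖ ^ (-((n : ℝ) - γ)) : ℝ) * ∫ s in (0 : ℝ)..(‖x‖ * R),
        Complex.exp (Complex.I * ((t / ‖x‖ * s : ℝ) : ℂ)) * (((s ^ ((n : ℝ) - 1 - γ) : ℝ) : ℂ) * Φ s)) := by
  have : Nonempty (Fin n) := ⟨⟨0, by omega⟩⟩
  have hN : Module.finrank ℝ (EuclideanSpace ℝ (Fin n)) = n := by simp
  have hxp : 0 < ‖x‖ := norm_pos_iff.2 hx
  have hpow : ∀ r : ℝ, 0 < r → r ^ (n - 1) * r ^ (-γ) = r ^ ((n : ℝ) - 1 - γ) := fun r hr => by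
    rw [← Real.rpow_natCast, ← Real.rpow_add hr, Nat.cast_sub (by omega)]
    congr 1; push_cast; ring
  unfold truncatedWaveKernel
  congr 1
  -- The cutoff to the ball is radial, so it is absorbed into the radial factor.
  let f : ℝ → ℂ := (Set.Iic R).indicator fun r =>
    Complex.exp (Complex.I * ((t * r : ℝ) : ℂ)) * ((r ^ (-γ) : ℝ) : ℂ)
  have h1 : ∀ ξ : EuclideanSpace ℝ (Fin n), (Metric.closedBall 0 R).indicator (fun ξ =>
      Complex.exp (Complex.I * ((inner ℝ x ξ + t * ‖ξ‖ : ℝ) : ℂ)) * ((‖ξ‖ ^ (-γ) : ℝ) : ℂ)) ξ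
      = Complex.exp (Complex.I * ((inner ℝ x ξ : ℝ) : ℂ)) * f ‖ξ‖ := by
    intro ξ
    by_cases h : ‖ξ‖ ≤ R
    · rw [Set.indicator_of_mem (by simpa using h)]
      simp only [f]
      rw [Set.indicator_of_mem (by simpa using h), Complex.ofReal_add, mul_add, Complex.exp_add,
        mul_assoc]
    · rw [Set.indicator_of_notMem (by simpa using h)]
      simp only [f]
      rw [Set.indicator_of_notMem (by simpa using h), mul_zero]
  have h2 : IntegrableOn (fun r : ℝ => r ^ (n - 1) • f r) (Set.Ioi 0) := by
    have h3 : IntegrableOn (fun r : ℝ => Complex.exp (Complex.I * ((t * r : ℝ) : ℂ)) *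
        ((r ^ ((n : ℝ) - 1 - γ) : ℝ) : ℂ)) (Set.Ioc 0 R) := by
      rw [← intervalIntegrable_iff_integrableOn_Ioc_of_le hR]
      refine ContinuousOn.intervalIntegrable ?_
      refine Continuous.continuousOn ?_
      have : Continuous fun r : ℝ => r ^ ((n : ℝ) - 1 - γ) :=
        Real.continuous_rpow_const (by linarith)
      fun_prop
    have h4 : (fun r : ℝ => r ^ (n - 1) • f r) =ᵐ[volume.restrict (Set.Ioi 0)]
        (Set.Iic R).indicator fun r : ℝ => Complex.exp (Complex.I * ((t * r : ℝ) : ℂ)) *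
        ((r ^ ((n : ℝ) - 1 - γ) : ℝ) : ℂ) := by
      filter_upwards [ae_restrict_mem measurableSet_Ioi] with r hr
      by_cases h : r ≤ R
      · simp only [f]
        rw [Set.indicator_of_mem (by simpa using h), Set.indicator_of_mem (by simpa using h),
          ← hpow r hr, Complex.real_smul]
        push_cast; ring
      · simp only [f]
        rw [Set.indicator_of_notMem (by simpa using h), Set.indicator_of_notMem (by simpa using h),
          smul_zero]
    rw [IntegrableOn, integrable_congr h4, integrable_indicator_iff measurableSet_Iic,
      IntegrableOn, Measure.restrict_restrict measurableSet_Iic, Set.inter_comm, Set.Ioi_inter_Iic]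
    exact h3
  have h5 := integral_exp_mul_radial x f (by rwa [hN])
  rw [hN] at h5
  rw [← integral_indicator Metric.isClosed_closedBall.measurableSet]
  simp only [h1]
  rw [h5]
  have h6 : ∫ r in Set.Ioi (0 : ℝ), r ^ (n - 1) • (f r * sphereTransform (r • x)) =
      ∫ r in (0 : ℝ)..R, (Complex.exp (Complex.I * ((t * r : ℝ) : ℂ)) *
        (((r ^ ((n : ℝ) - 1 - γ) : ℝ) : ℂ) * Φ (‖x‖ * r))) := by
    rw [intervalIntegral.integral_of_le hR, ← Set.Ioi_inter_Iic, Set.inter_comm,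
      ← Measure.restrict_restrict measurableSet_Iic, ← integral_indicator measurableSet_Iic]
    refine setIntegral_congr_fun measurableSet_Ioi fun r hr => ?_
    have hr' : (0 : ℝ) < r := hr
    have hnorm : ‖r • x‖ = ‖x‖ * r := by
      rw [norm_smul, Real.norm_of_nonneg hr'.le, mul_comm]
    simp only [f]
    by_cases h : r ≤ R
    · rw [Set.indicator_of_mem (by simpa using h), Set.indicator_of_mem (by simpa using h),
          ← hpow r hr', Complex.real_smul, hΦ, hnorm]
      push_cast; ring
    · rw [Set.indicator_of_notMem (by simpa using h), Set.indicator_of_notMem (by simpa using h),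
          zero_mul, smul_zero]
  rw [h6]
  -- Substitution `s = ‖x‖ r`: the power of `r` contributes `‖x‖^(-(n-1-γ))` and `dr` one more
  -- `‖x‖⁻¹`.
  have h7 := intervalIntegral.integral_comp_mul_left (a := 0) (b := R) (fun s : ℝ =>
    Complex.exp (Complex.I * ((t / ‖x‖ * s : ℝ) : ℂ)) * (((s ^ ((n : ℝ) - 1 - γ) : ℝ) : ℂ) * Φ s))
    hxp.ne'
  rw [mul_zero] at h7
  have h8 : ∫ r in (0 : ℝ)..R, (Complex.exp (Complex.I * ((t * r : ℝ) : ℂ)) *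
        (((r ^ ((n : ℝ) - 1 - γ) : ℝ) : ℂ) * Φ (‖x‖ * r))) =
      ((‖x‖ ^ (-((n : ℝ) - 1 - γ)) : ℝ) : ℂ) * ∫ r in (0 : ℝ)..R,
        Complex.exp (Complex.I * ((t / ‖x‖ * (‖x‖ * r) : ℝ) : ℂ)) *
          ((((‖x‖ * r) ^ ((n : ℝ) - 1 - γ) : ℝ) : ℂ) * Φ (‖x‖ * r)) := by
    rw [← intervalIntegral.integral_const_mul]
    refine intervalIntegral.integral_congr fun r hr => ?_
    rw [Set.uIcc_of_le hR] at hr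
    have e1 : t / ‖x‖ * (‖x‖ * r) = t * r := by field_simp
    have e2 : ((‖x‖ ^ (-((n : ℝ) - 1 - γ)) : ℝ) : ℂ) * ((‖x‖ ^ ((n : ℝ) - 1 - γ) : ℝ) : ℂ) = 1 := by
      rw [← Complex.ofReal_mul, ← Real.rpow_add hxp, neg_add_cancel, Real.rpow_zero,
        Complex.ofReal_one]
    simp only [e1]
    rw [Real.mul_rpow hxp.le hr.1, Complex.ofReal_mul (‖x‖ ^ ((n : ℝ) - 1 - γ))]
    linear_combination (-(Complex.exp (Complex.I * ((t * r : ℝ) : ℂ)) *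
        (((r ^ ((n : ℝ) - 1 - γ) : ℝ) : ℂ) * Φ (‖x‖ * r)))) * e2
  rw [h8, h7, Complex.real_smul, ← mul_assoc, ← Complex.ofReal_mul, ← Real.rpow_neg_one ‖x‖,
    ← Real.rpow_add hxp]
  congr 4
  ring

/-! ### Energy bound and basic tail estimates -/

section Oscillatory

open Set

/-- Solutions of `v'' + (1 - k / s²) v = 0` are bounded at infinity, together with their
derivatives. -/
theorem exists_bound_of_inverse_square_potential {k : ℝ} {v v₁ : ℝ → ℂ}
    (hv : ∀ s, 1 ≤ s → HasDerivAt v (v₁ s) s)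
    (hv₁ : ∀ s, 1 ≤ s → HasDerivAt v₁ (-(v s) + (k / s ^ 2 : ℝ) • v s) s) :
    ∃ M, 0 ≤ M ∧ ∀ s, 1 ≤ s → ‖v s‖ ≤ M ∧ ‖v₁ s‖ ≤ M := by
  -- The energy `|v|² + |v₁|²` grows at relative rate at most `|k|/s²`. The weight `exp (|k|/s)`
  -- cancels this growth, making `G` antitone; as the weight is at least `1`, `G 1` bounds the
  -- energy.
  let G : ℝ → ℝ := fun s => (‖v s‖ ^ 2 + ‖v₁ s‖ ^ 2) * Real.exp (|k| / s)
  let G' : ℝ → ℝ := fun s => (2 * inner ℝ (v s) (v₁ s) +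
    2 * inner ℝ (v₁ s) (-(v s) + (k / s ^ 2 : ℝ) • v s)) * Real.exp (|k| / s) +
      (‖v s‖ ^ 2 + ‖v₁ s‖ ^ 2) * (Real.exp (|k| / s) * (-|k| / s ^ 2))
  have hG : ∀ s, 1 ≤ s → HasDerivAt G (G' s) s := by
    intro s hs
    have h0 : s ≠ 0 := by positivity
    have h1 : HasDerivAt (fun s : ℝ => Real.exp (|k| / s))
        (Real.exp (|k| / s) * (-|k| / s ^ 2)) s := by
      have := ((hasDerivAt_const s |k|).div (hasDerivAt_id s) h0).exp
      refine this.congr_deriv ?_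
      simp
    exact ((hv s hs).norm_sq.add (hv₁ s hs).norm_sq).mul h1
  have hG' : ∀ s, 1 ≤ s → G' s ≤ 0 := by
    intro s hs
    have hs2 : 0 < s ^ 2 := by positivity
    have h1 : |inner ℝ (v₁ s) (v s)| ≤ ‖v₁ s‖ * ‖v s‖ := abs_real_inner_le_norm _ _
    have h2 : k / s ^ 2 * (2 * inner ℝ (v₁ s) (v s)) ≤ |k| / s ^ 2 * (‖v s‖ ^ 2 + ‖v₁ s‖ ^ 2) := by
      refine (le_abs_self _).trans ?_
      rw [abs_mul, abs_div, abs_of_pos hs2, abs_mul, abs_two]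
      gcongr
      nlinarith [sq_nonneg (‖v s‖ - ‖v₁ s‖)]
    have h3 : G' s = (k / s ^ 2 * (2 * inner ℝ (v₁ s) (v s)) -
        |k| / s ^ 2 * (‖v s‖ ^ 2 + ‖v₁ s‖ ^ 2)) * Real.exp (|k| / s) := by
      simp only [G', inner_add_right, inner_neg_right, real_inner_smul_right]
      rw [real_inner_comm (v₁ s) (v s)]
      ring
    rw [h3]
    exact mul_nonpos_of_nonpos_of_nonneg (by linarith) (Real.exp_pos _).le
  have hanti : AntitoneOn G (Ici 1) := by
    refine antitoneOn_of_deriv_nonpos (convex_Ici 1)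
      (fun s hs => (hG s hs).continuousAt.continuousWithinAt)
      (fun s hs => (hG s (interior_subset hs)).differentiableAt.differentiableWithinAt)
      (fun s hs => ?_)
    rw [(hG s (interior_subset hs)).deriv]
    exact hG' s (interior_subset hs)
  refine ⟨Real.sqrt (G 1), Real.sqrt_nonneg _, fun s hs => ?_⟩
  have h1 : G s ≤ G 1 := hanti self_mem_Ici hs hs
  have h2 : ‖v s‖ ^ 2 + ‖v₁ s‖ ^ 2 ≤ G 1 := by
    refine le_trans ?_ h1
    exact le_mul_of_one_le_right (by positivity) (Real.one_le_exp (by positivity))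
  exact ⟨Real.le_sqrt_of_sq_le (by nlinarith [sq_nonneg ‖v₁ s‖]),
    Real.le_sqrt_of_sq_le (by nlinarith [sq_nonneg ‖v s‖])⟩

theorem continuousOn_rpow_Ici_one (b : ℝ) : ContinuousOn (fun s : ℝ => s ^ b) (Ici 1) :=
  fun s hs => (Real.continuousAt_rpow_const s b
    (Or.inl (by have : (1:ℝ) ≤ s := hs; positivity))).continuousWithinAt

theorem norm_exp_mul_rpow_mul {l b s : ℝ} (hs : 1 ≤ s) (z : ℂ) :
    ‖Complex.exp (Complex.I * ((l * s : ℝ) : ℂ)) * (((s ^ b : ℝ) : ℂ) * z)‖ = s ^ b * ‖z‖ := by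
  rw [norm_mul, Complex.norm_exp_I_mul_ofReal, one_mul, norm_mul, Complex.norm_real,
    Real.norm_of_nonneg (by positivity)]

/-- Absolutely convergent tails. -/
theorem exists_tendsto_of_one_lt {a M N : ℝ} (ha : 1 < a) (hN : 1 ≤ N) {w : ℝ → ℂ}
    (hw : ContinuousOn w (Ici 1)) (hM : ∀ s, 1 ≤ s → ‖w s‖ ≤ M) (l : ℝ) :
    ∃ L, Tendsto (fun T : ℝ => ∫ s in N..T, Complex.exp (Complex.I * ((l * s : ℝ) : ℂ)) *
      (((s ^ (-a) : ℝ) : ℂ) * w s)) atTop (𝓝 L) ∧ ‖L‖ ≤ M * (N ^ (1 - a) / (a - 1)) := by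
  have hN0 : 0 < N := by linarith
  have hsub : Ioi N ⊆ Ici 1 := fun s hs => hN.trans (le_of_lt hs)
  have hint : IntegrableOn (fun s : ℝ => M * s ^ (-a)) (Ioi N) :=
    (integrableOn_Ioi_rpow_of_lt (by linarith) hN0).const_mul M
  have hb : ∀ᵐ s ∂(volume.restrict (Ioi N)), ‖Complex.exp (Complex.I * ((l * s : ℝ) : ℂ)) *
      (((s ^ (-a) : ℝ) : ℂ) * w s)‖ ≤ M * s ^ (-a) := by
    filter_upwards [ae_restrict_mem measurableSet_Ioi] with s hs
    have hs1 : 1 ≤ s := hsub hs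
    rw [norm_exp_mul_rpow_mul hs1, mul_comm]
    gcongr
    exact hM s hs1
  have hc : ContinuousOn (fun s : ℝ => Complex.exp (Complex.I * ((l * s : ℝ) : ℂ)) *
      (((s ^ (-a) : ℝ) : ℂ) * w s)) (Ici 1) := by
    have := continuousOn_rpow_Ici_one (-a)
    fun_prop
  have hint' : IntegrableOn (fun s : ℝ => Complex.exp (Complex.I * ((l * s : ℝ) : ℂ)) *
      (((s ^ (-a) : ℝ) : ℂ) * w s)) (Ioi N) :=
    hint.mono' ((hc.mono hsub).aestronglyMeasurable measurableSet_Ioi) hb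
  refine ⟨_, intervalIntegral_tendsto_integral_Ioi N hint' tendsto_id, ?_⟩
  refine (norm_integral_le_of_norm_le hint hb).trans (le_of_eq ?_)
  rw [integral_const_mul, integral_Ioi_rpow_of_lt (by linarith) hN0,
    show -a + 1 = 1 - a by ring, ← neg_sub a 1, neg_div_neg_eq]

/-- Oscillatory tails with a slowly varying amplitude. -/
theorem exists_tendsto_of_slowly_varying {a M : ℝ} (ha : 0 < a) (ha1 : a < 1) {q q' : ℝ → ℂ}
    (hq : ∀ s, 1 ≤ s → HasDerivAt q (q' s) s) (hq' : ContinuousOn q' (Ici 1))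
    (hM : ∀ s, 1 ≤ s → ‖q s‖ ≤ M) (hM' : ∀ s, 1 ≤ s → ‖q' s‖ ≤ M / s ^ 2) {l : ℝ} (hl : l ≠ 0) :
    ∃ L, Tendsto (fun T : ℝ => ∫ s in (1 : ℝ)..T, Complex.exp (Complex.I * ((l * s : ℝ) : ℂ)) *
      (((s ^ (-a) : ℝ) : ℂ) * q s)) atTop (𝓝 L) ∧
      ‖L‖ ≤ (1 / (1 - a) + 1 + (a + 1) / a) * M * (1 + |l| ^ (a - 1)) := by
  have hM0 : 0 ≤ M := (norm_nonneg _).trans (hM 1 le_rfl)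
  have hl0 : 0 < |l| := abs_pos.2 hl
  -- Beyond `|l|⁻¹` the phase oscillates and integration by parts pays off; before it, absolute
  -- values are taken.
  set N : ℝ := max 1 |l|⁻¹ with hNdef
  have hN : 1 ≤ N := le_max_left _ _
  have hN0 : 0 < N := by linarith
  have hNl : |l|⁻¹ ≤ N := le_max_right _ _
  have hsub : Ioi N ⊆ Ici 1 := fun s hs => hN.trans (le_of_lt hs)
  have hqc : ContinuousOn q (Ici 1) := fun s hs => (hq s hs).continuousAt.continuousWithinAt
  have hpc := continuousOn_rpow_Ici_one
  let e : ℝ → ℂ := fun s => Complex.exp (Complex.I * ((l * s : ℝ) : ℂ))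
  have hec : Continuous e := by fun_prop
  have hen : ∀ s, ‖e s‖ = 1 := fun s => Complex.norm_exp_I_mul_ofReal _
  have hIl : Complex.I * (l : ℂ) ≠ 0 := mul_ne_zero Complex.I_ne_zero (by exact_mod_cast hl)
  have hIln : ‖Complex.I * (l : ℂ)‖ = |l| := by simp
  let W : ℝ → ℂ := fun s => ((s ^ (-a) : ℝ) : ℂ) * q s
  let W' : ℝ → ℂ := fun s => ((-a * s ^ (-a - 1) : ℝ) : ℂ) * q s + ((s ^ (-a) : ℝ) : ℂ) * q' s
  let F : ℝ → ℂ := fun s => e s / (Complex.I * l)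
  have hF : ∀ s, HasDerivAt F (e s) s := by
    intro s
    have h1 : HasDerivAt (fun h : ℝ => Complex.I * ((l * h : ℝ) : ℂ)) (Complex.I * l) s := by
      have := ((hasDerivAt_id s).const_mul l).ofReal_comp.const_mul Complex.I
      simpa using this
    exact (h1.cexp.div_const (Complex.I * l)).congr_deriv (mul_div_cancel_right₀ _ hIl)
  have hFn : ∀ s, ‖F s‖ = |l|⁻¹ := fun s => by rw [norm_div, hen, hIln, one_div]
  have hW : ∀ s, 1 ≤ s → HasDerivAt W (W' s) s := by
    intro s hs
    have h1 := (Real.hasDerivAt_rpow_const (x := s) (p := -a) (Or.inl (by positivity))).ofReal_comp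
    exact h1.mul (hq s hs)
  have hWc : ContinuousOn W (Ici 1) := fun s hs => (hW s hs).continuousAt.continuousWithinAt
  have hWc' : ContinuousOn W' (Ici 1) := by
    have h1 := hpc (-a)
    have h2 := hpc (-a - 1)
    fun_prop
  have hWn : ∀ s, 1 ≤ s → ‖W s‖ ≤ M * s ^ (-a) := by
    intro s hs
    rw [norm_mul, Complex.norm_real, Real.norm_of_nonneg (by positivity), mul_comm]
    gcongr
    exact hM s hs
  have hWn' : ∀ s, 1 ≤ s → ‖W' s‖ ≤ (a + 1) * M * s ^ (-a - 1) := by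
    intro s hs
    have hs0 : 0 < s := by linarith
    have h1 : ‖((-a * s ^ (-a - 1) : ℝ) : ℂ) * q s‖ ≤ a * M * s ^ (-a - 1) := by
      rw [norm_mul, Complex.norm_real, norm_mul, norm_neg, Real.norm_of_nonneg ha.le,
        Real.norm_of_nonneg (by positivity), mul_right_comm]
      gcongr
      exact hM s hs
    have h2 : ‖((s ^ (-a) : ℝ) : ℂ) * q' s‖ ≤ M * s ^ (-a - 1) := by
      rw [norm_mul, Complex.norm_real, Real.norm_of_nonneg (by positivity)]
      calc s ^ (-a) * ‖q' s‖ ≤ s ^ (-a) * (M / s ^ 2) := by gcongr; exact hM' s hs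
        _ ≤ s ^ (-a) * (M / s ^ 1) := by gcongr; norm_num
        _ = M * s ^ (-a - 1) := by rw [Real.rpow_sub_one hs0.ne']; ring
    refine (norm_add_le _ _).trans ((add_le_add h1 h2).trans (le_of_eq (by ring)))
  have hbint : IntegrableOn (fun s : ℝ => |l|⁻¹ * ((a + 1) * M) * s ^ (-a - 1)) (Ioi N) :=
    (integrableOn_Ioi_rpow_of_lt (by linarith) hN0).const_mul _
  have hb : ∀ᵐ s ∂(volume.restrict (Ioi N)), ‖W' s * F s‖ ≤
      |l|⁻¹ * ((a + 1) * M) * s ^ (-a - 1) := by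
    filter_upwards [ae_restrict_mem measurableSet_Ioi] with s hs
    rw [norm_mul, hFn, mul_comm, mul_assoc]
    gcongr
    exact hWn' s (hsub hs)
  have hFc : Continuous F := hec.div_const _
  have hint' : IntegrableOn (fun s : ℝ => W' s * F s) (Ioi N) :=
    hbint.mono' (((hWc'.mul hFc.continuousOn).mono hsub).aestronglyMeasurable measurableSet_Ioi) hb
  have hparts : ∀ T, N ≤ T → ∫ s in (1 : ℝ)..T, e s * W s =
      (∫ s in (1 : ℝ)..N, e s * W s) + (W T * F T - W N * F N - ∫ s in N..T, W' s * F s) := by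
    intro T hT
    have hsub1 : uIcc 1 N ⊆ Ici 1 := by rw [uIcc_of_le hN]; exact Icc_subset_Ici_self
    have hsub2 : uIcc N T ⊆ Ici 1 := by
      rw [uIcc_of_le hT]; exact fun s hs => hN.trans hs.1
    have hewc : ContinuousOn (fun s => e s * W s) (Ici 1) := hec.continuousOn.mul hWc
    rw [← intervalIntegral.integral_add_adjacent_intervals
      (hewc.mono hsub1).intervalIntegrable (hewc.mono hsub2).intervalIntegrable]
    congr 1
    rw [← intervalIntegral.integral_mul_deriv_eq_deriv_mul (u := W) (v := F) (u' := W') (v' := e)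
      (fun s hs => hW s (hsub2 hs)) (fun s _ => hF s)
      (hWc'.mono hsub2).intervalIntegrable (hec.intervalIntegrable _ _)]
    simp only [mul_comm]
  have hlim0 : Tendsto (fun T => W T * F T) atTop (𝓝 0) := by
    have h1 : Tendsto (fun T : ℝ => M * T ^ (-a) * |l|⁻¹) atTop (𝓝 0) := by
      simpa using ((tendsto_rpow_neg_atTop ha).const_mul M).mul_const |l|⁻¹
    refine squeeze_zero_norm' ?_ h1
    filter_upwards [eventually_ge_atTop 1] with T hT
    rw [norm_mul, hFn]
    gcongr
    exact hWn T hT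
  -- The three terms of the constant come from `[1, N]`, from the boundary term at `N`, and from the
  -- integral of `W' F` over `(N, ∞)`. Each is at most its constant times `M N^(1-a)`.
  refine ⟨(∫ s in (1 : ℝ)..N, e s * W s) + (0 - W N * F N - ∫ s in Ioi N, W' s * F s), ?_, ?_⟩
  · have h1 := intervalIntegral_tendsto_integral_Ioi N hint' tendsto_id
    have h2 := ((hlim0.sub_const (W N * F N)).sub h1).const_add (∫ s in (1 : ℝ)..N, e s * W s)
    refine h2.congr' ?_
    filter_upwards [eventually_ge_atTop N] with T hT
    exact (hparts T hT).symm
  · have h1 : ‖∫ s in (1 : ℝ)..N, e s * W s‖ ≤ M * (N ^ (1 - a) * (1 / (1 - a))) := by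
      have hii : IntervalIntegrable (fun s : ℝ => M * s ^ (-a)) volume 1 N :=
        (intervalIntegral.intervalIntegrable_rpow' (by linarith)).const_mul M
      refine (intervalIntegral.norm_integral_le_of_norm_le hN
        (.of_forall fun s hs => ?_) hii).trans ?_
      · rw [norm_mul, hen, one_mul]
        exact hWn s hs.1.le
      · rw [intervalIntegral.integral_const_mul, integral_rpow (Or.inl (by linarith)),
          show -a + 1 = 1 - a by ring, Real.one_rpow, div_eq_mul_one_div]
        have : 0 < 1 - a := by linarith
        gcongr
        linarith
    have hN2 : |l|⁻¹ * N ^ (-a) ≤ N ^ (1 - a) := by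
      rw [show (1:ℝ) - a = 1 + -a by ring, Real.rpow_add hN0, Real.rpow_one]
      gcongr
    have h2 : ‖W N * F N‖ ≤ M * N ^ (1 - a) := by
      rw [norm_mul, hFn]
      calc ‖W N‖ * |l|⁻¹ ≤ M * N ^ (-a) * |l|⁻¹ := by gcongr; exact hWn N hN
        _ = M * (|l|⁻¹ * N ^ (-a)) := by ring
        _ ≤ _ := by gcongr
    have h3 : ‖∫ s in Ioi N, W' s * F s‖ ≤ M * (N ^ (1 - a) * ((a + 1) / a)) := by
      refine (norm_integral_le_of_norm_le hbint hb).trans ?_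
      rw [integral_const_mul, integral_Ioi_rpow_of_lt (by linarith) hN0, sub_add_cancel,
        neg_div_neg_eq]
      calc _ = M * ((|l|⁻¹ * N ^ (-a)) * ((a + 1) / a)) := by ring
        _ ≤ _ := by gcongr
    have h4 : N ^ (1 - a) ≤ 1 + |l| ^ (a - 1) := by
      rcases max_choice 1 |l|⁻¹ with h | h
      · rw [hNdef, h, Real.one_rpow]
        exact le_add_of_nonneg_right (by positivity)
      · rw [hNdef, h, Real.inv_rpow hl0.le, ← Real.rpow_neg hl0.le, neg_sub]
        linarith
    have h5 : (0:ℝ) ≤ 1 / (1 - a) := one_div_nonneg.2 (by linarith)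
    have h6 : ‖(0:ℂ) - W N * F N - ∫ s in Ioi N, W' s * F s‖ ≤
        M * N ^ (1 - a) + M * (N ^ (1 - a) * ((a + 1) / a)) := by
      refine (norm_sub_le _ _).trans (add_le_add ?_ h3)
      rwa [zero_sub, norm_neg]
    refine (norm_add_le _ _).trans ((add_le_add h1 h6).trans ?_)
    calc _ = (1 / (1 - a) + 1 + (a + 1) / a) * M * N ^ (1 - a) := by ring
      _ ≤ _ := by gcongr

end Oscillatory

/-! ### Tails of solutions and integrals over the half-line -/

section Oscillatory

open Set

/-- Oscillatory tails of functions with the asymptotics `c₁ e^{is} p + c₂ e^{-is} q`. -/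
theorem exists_tendsto_of_asymptotics {a M : ℝ} (ha : 0 < a) (ha1 : a < 1) {p p' q q' w : ℝ → ℂ}
    (hp : ∀ s, 1 ≤ s → HasDerivAt p (p' s) s) (hp' : ContinuousOn p' (Ici 1))
    (hpM : ∀ s, 1 ≤ s → ‖p s‖ ≤ M) (hpM' : ∀ s, 1 ≤ s → ‖p' s‖ ≤ M / s ^ 2)
    (hq : ∀ s, 1 ≤ s → HasDerivAt q (q' s) s) (hq' : ContinuousOn q' (Ici 1))
    (hqM : ∀ s, 1 ≤ s → ‖q s‖ ≤ M) (hqM' : ∀ s, 1 ≤ s → ‖q' s‖ ≤ M / s ^ 2)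
    {c₁ c₂ : ℂ} (hc₁ : ‖c₁‖ ≤ 1) (hc₂ : ‖c₂‖ ≤ 1)
    (hw : ∀ s, 1 ≤ s → w s = c₁ * (Complex.exp (Complex.I * s) * p s) +
      c₂ * (Complex.exp (-(Complex.I * s)) * q s)) :
    ∃ C, 0 ≤ C ∧ ∀ l : ℝ, |l| ≠ 1 → ∃ L,
      Tendsto (fun T : ℝ => ∫ s in (1 : ℝ)..T, Complex.exp (Complex.I * ((l * s : ℝ) : ℂ)) *
        (((s ^ (-a) : ℝ) : ℂ) * w s)) atTop (𝓝 L) ∧ ‖L‖ ≤ C * |(|l| - 1)| ^ (a - 1) + C := by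
  have hM0 : 0 ≤ M := (norm_nonneg _).trans (hpM 1 le_rfl)
  have ha2 : 0 < 1 - a := by linarith
  set K : ℝ := (1 / (1 - a) + 1 + (a + 1) / a) * M with hK
  have hK0 : 0 ≤ K := by positivity
  refine ⟨2 * K, by positivity, fun l hl => ?_⟩
  have hd : 0 < |(|l| - 1)| := abs_pos.2 (sub_ne_zero.2 hl)
  have hplus : l + 1 ≠ 0 := fun h => hl (by rw [eq_neg_of_add_eq_zero_left h]; simp)
  have hminus : l - 1 ≠ 0 := fun h => hl (by rw [sub_eq_zero.1 h]; simp)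
  -- Both shifted frequencies `l ± 1` are at distance at least `||l| - 1|` from `0`, and `a - 1 < 0`
  -- reverses the inequality for the powers.
  have hd1 : |(|l| - 1)| ≤ |l + 1| := by
    have := abs_abs_sub_abs_le_abs_sub l (-1)
    simpa using this
  have hd2 : |(|l| - 1)| ≤ |l - 1| := by
    have := abs_abs_sub_abs_le_abs_sub l 1
    simpa using this
  obtain ⟨L₁, h1, h1'⟩ := exists_tendsto_of_slowly_varying ha ha1 hp hp' hpM hpM' hplus
  obtain ⟨L₂, h2, h2'⟩ := exists_tendsto_of_slowly_varying ha ha1 hq hq' hqM hqM' hminus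
  have hb1 : |l + 1| ^ (a - 1) ≤ |(|l| - 1)| ^ (a - 1) :=
    Real.rpow_le_rpow_of_nonpos hd hd1 (by linarith)
  have hb2 : |l - 1| ^ (a - 1) ≤ |(|l| - 1)| ^ (a - 1) :=
    Real.rpow_le_rpow_of_nonpos hd hd2 (by linarith)
  refine ⟨c₁ * L₁ + c₂ * L₂, ?_, ?_⟩
  · refine ((h1.const_mul c₁).add (h2.const_mul c₂)).congr' ?_
    filter_upwards [eventually_ge_atTop 1] with T hT
    have hsub : uIcc 1 T ⊆ Ici 1 := by rw [uIcc_of_le hT]; exact Icc_subset_Ici_self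
    have hpc : ContinuousOn p (Ici 1) := fun s hs => (hp s hs).continuousAt.continuousWithinAt
    have hqc : ContinuousOn q (Ici 1) := fun s hs => (hq s hs).continuousAt.continuousWithinAt
    have hr := continuousOn_rpow_Ici_one (-a)
    have e1 : ContinuousOn (fun s : ℝ => c₁ * (Complex.exp (Complex.I * (((l + 1) * s : ℝ) : ℂ)) *
      (((s ^ (-a) : ℝ) : ℂ) * p s))) (Ici 1) := by fun_prop
    have e2 : ContinuousOn (fun s : ℝ => c₂ * (Complex.exp (Complex.I * (((l - 1) * s : ℝ) : ℂ)) *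
      (((s ^ (-a) : ℝ) : ℂ) * q s))) (Ici 1) := by fun_prop
    rw [← intervalIntegral.integral_const_mul, ← intervalIntegral.integral_const_mul,
      ← intervalIntegral.integral_add (e1.mono hsub).intervalIntegrable
        (e2.mono hsub).intervalIntegrable]
    refine intervalIntegral.integral_congr fun s hs => ?_
    simp only [hw s (hsub hs)]
    have h3 : Complex.exp (Complex.I * (((l + 1) * s : ℝ) : ℂ)) =
        Complex.exp (Complex.I * ((l * s : ℝ) : ℂ)) * Complex.exp (Complex.I * s) := by
      rw [← Complex.exp_add]; congr 1; push_cast; ring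
    have h4 : Complex.exp (Complex.I * (((l - 1) * s : ℝ) : ℂ)) =
        Complex.exp (Complex.I * ((l * s : ℝ) : ℂ)) * Complex.exp (-(Complex.I * s)) := by
      rw [← Complex.exp_add]; congr 1; push_cast; ring
    rw [h3, h4]
    ring
  · have h3 : ‖c₁ * L₁‖ ≤ K * (1 + |(|l| - 1)| ^ (a - 1)) := by
      rw [norm_mul]
      calc ‖c₁‖ * ‖L₁‖ ≤ 1 * (K * (1 + |l + 1| ^ (a - 1))) := by gcongr
        _ ≤ _ := by rw [one_mul]; gcongr
    have h4 : ‖c₂ * L₂‖ ≤ K * (1 + |(|l| - 1)| ^ (a - 1)) := by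
      rw [norm_mul]
      calc ‖c₂‖ * ‖L₂‖ ≤ 1 * (K * (1 + |l - 1| ^ (a - 1))) := by gcongr
        _ ≤ _ := by rw [one_mul]; gcongr
    refine (norm_add_le _ _).trans ((add_le_add h3 h4).trans (le_of_eq (by ring)))

/-- Oscillatory tails of solutions of `v'' + (1 - k / s²) v = 0` and of their derivatives. -/
theorem exists_tendsto_of_inverse_square_potential {a k : ℝ} (ha : 0 < a) (ha1 : a < 1)
    {v v₁ : ℝ → ℂ} (hv : ∀ s, 1 ≤ s → HasDerivAt v (v₁ s) s)
    (hv₁ : ∀ s, 1 ≤ s → HasDerivAt v₁ (-(v s) + (k / s ^ 2 : ℝ) • v s) s) :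
    ∃ C, 0 ≤ C ∧ ∀ l : ℝ, |l| ≠ 1 →
      (∃ L, Tendsto (fun T : ℝ => ∫ s in (1 : ℝ)..T, Complex.exp (Complex.I * ((l * s : ℝ) : ℂ)) *
        (((s ^ (-a) : ℝ) : ℂ) * v s)) atTop (𝓝 L) ∧ ‖L‖ ≤ C * |(|l| - 1)| ^ (a - 1) + C) ∧
      (∃ L, Tendsto (fun T : ℝ => ∫ s in (1 : ℝ)..T, Complex.exp (Complex.I * ((l * s : ℝ) : ℂ)) *
        (((s ^ (-a) : ℝ) : ℂ) * v₁ s)) atTop (𝓝 L) ∧ ‖L‖ ≤ C * |(|l| - 1)| ^ (a - 1) + C) := by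
  obtain ⟨M, hM0, hM⟩ := exists_bound_of_inverse_square_potential hv hv₁
  have hvc : ContinuousOn v (Ici 1) := fun s hs => (hv s hs).continuousAt.continuousWithinAt
  have hexpn : ∀ s : ℝ, ‖Complex.exp (Complex.I * s)‖ = 1 := Complex.norm_exp_I_mul_ofReal
  have hexpn' : ∀ s : ℝ, ‖Complex.exp (-(Complex.I * s))‖ = 1 := fun s => by
    rw [Complex.exp_neg, norm_inv, hexpn, inv_one]
  have hexp : ∀ s : ℝ, HasDerivAt (fun s : ℝ => Complex.exp (Complex.I * s))
      (Complex.exp (Complex.I * s) * Complex.I) s := fun s => by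
    have := ((hasDerivAt_id s).ofReal_comp.const_mul Complex.I).cexp
    simpa using this
  have hexp' : ∀ s : ℝ, HasDerivAt (fun s : ℝ => Complex.exp (-(Complex.I * s)))
      (Complex.exp (-(Complex.I * s)) * -Complex.I) s := fun s => by
    have := ((hasDerivAt_id s).ofReal_comp.const_mul Complex.I).neg.cexp
    simpa using this
  have hee : ∀ s : ℝ, Complex.exp (Complex.I * s) * Complex.exp (-(Complex.I * s)) = 1 := fun s => by
    rw [← Complex.exp_add, add_neg_cancel, Complex.exp_zero]
  -- Variation of constants for `v'' + v = 0`: `p` and `q` would be constant if `k = 0`, so their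
  -- derivatives contain only the potential term `k v / s²`.
  let p : ℝ → ℂ := fun s => Complex.exp (-(Complex.I * s)) * (v₁ s + Complex.I * v s)
  let q : ℝ → ℂ := fun s => Complex.exp (Complex.I * s) * (v₁ s - Complex.I * v s)
  let p' : ℝ → ℂ := fun s => Complex.exp (-(Complex.I * s)) * (((k / s ^ 2 : ℝ) : ℂ) * v s)
  let q' : ℝ → ℂ := fun s => Complex.exp (Complex.I * s) * (((k / s ^ 2 : ℝ) : ℂ) * v s)
  have hp : ∀ s, 1 ≤ s → HasDerivAt p (p' s) s := fun s hs => by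
    refine ((hexp' s).mul ((hv₁ s hs).add ((hv s hs).const_mul Complex.I))).congr_deriv ?_
    simp only [p', Complex.real_smul, Pi.add_apply]
    linear_combination (-Complex.exp (-(Complex.I * s)) * v s) * Complex.I_sq
  have hq : ∀ s, 1 ≤ s → HasDerivAt q (q' s) s := fun s hs => by
    refine ((hexp s).mul ((hv₁ s hs).sub ((hv s hs).const_mul Complex.I))).congr_deriv ?_
    simp only [q', Complex.real_smul, Pi.sub_apply]
    linear_combination (-Complex.exp (Complex.I * s) * v s) * Complex.I_sq
  have hkc : ContinuousOn (fun s : ℝ => k / s ^ 2) (Ici 1) := by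
    refine ContinuousOn.div (by fun_prop) (by fun_prop) fun s hs => ?_
    have : (1:ℝ) ≤ s := hs
    positivity
  have hp' : ContinuousOn p' (Ici 1) := by fun_prop
  have hq' : ContinuousOn q' (Ici 1) := by fun_prop
  -- `2M + |k|M` serves both as a bound for the amplitudes (`2M`) and for the numerator of their
  -- derivatives (`|k|M`).
  have hpot : ∀ s, 1 ≤ s → ‖((k / s ^ 2 : ℝ) : ℂ) * v s‖ ≤ (2 * M + |k| * M) / s ^ 2 := by
    intro s hs
    have hs2 : 0 < s ^ 2 := by positivity
    rw [norm_mul, Complex.norm_real, Real.norm_eq_abs, abs_div, abs_of_pos hs2]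
    calc |k| / s ^ 2 * ‖v s‖ ≤ |k| / s ^ 2 * M := by gcongr; exact (hM s hs).1
      _ = (|k| * M) / s ^ 2 := by ring
      _ ≤ _ := by gcongr; linarith
  have hamp : ∀ s, 1 ≤ s → ‖v₁ s‖ + ‖Complex.I * v s‖ ≤ 2 * M + |k| * M := by
    intro s hs
    rw [norm_mul, Complex.norm_I, one_mul]
    have := hM s hs
    have : 0 ≤ |k| * M := by positivity
    linarith
  have hpM : ∀ s, 1 ≤ s → ‖p s‖ ≤ 2 * M + |k| * M := fun s hs => by
    rw [norm_mul, hexpn', one_mul]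
    exact (norm_add_le _ _).trans (hamp s hs)
  have hqM : ∀ s, 1 ≤ s → ‖q s‖ ≤ 2 * M + |k| * M := fun s hs => by
    rw [norm_mul, hexpn, one_mul]
    exact (norm_sub_le _ _).trans (hamp s hs)
  have hpM' : ∀ s, 1 ≤ s → ‖p' s‖ ≤ (2 * M + |k| * M) / s ^ 2 := fun s hs => by
    rw [norm_mul, hexpn', one_mul]
    exact hpot s hs
  have hqM' : ∀ s, 1 ≤ s → ‖q' s‖ ≤ (2 * M + |k| * M) / s ^ 2 := fun s hs => by
    rw [norm_mul, hexpn, one_mul]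
    exact hpot s hs
  have hhalf : ‖(1 / 2 : ℂ)‖ ≤ 1 := by norm_num
  have hhalfI : ‖(Complex.I / 2 : ℂ)‖ ≤ 1 := by
    rw [norm_div, Complex.norm_I, Complex.norm_ofNat]; norm_num
  obtain ⟨C₁, hC₁, h1⟩ := exists_tendsto_of_asymptotics (w := v) ha ha1 hp hp' hpM hpM' hq hq' hqM
    hqM' (c₁ := -(Complex.I / 2)) (c₂ := Complex.I / 2) (by rwa [norm_neg]) hhalfI fun s _ => by
      simp only [p, q]
      linear_combination (Complex.I * Complex.I * v s) * hee s + v s * Complex.I_sq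
  obtain ⟨C₂, hC₂, h2⟩ := exists_tendsto_of_asymptotics (w := v₁) ha ha1 hp hp' hpM hpM' hq hq' hqM
    hqM' (c₁ := 1 / 2) (c₂ := 1 / 2) hhalf hhalf fun s _ => by
      simp only [p, q]
      linear_combination (-v₁ s) * hee s
  refine ⟨C₁ + C₂, by positivity, fun l hl => ?_⟩
  obtain ⟨L₁, ht₁, hn₁⟩ := h1 l hl
  obtain ⟨L₂, ht₂, hn₂⟩ := h2 l hl
  refine ⟨⟨L₁, ht₁, hn₁.trans ?_⟩, ⟨L₂, ht₂, hn₂.trans ?_⟩⟩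
  · gcongr <;> linarith
  · gcongr <;> linarith

/-- The integral `∫ e^{ils} s^α Φ(s) ds` over `(0, ∞)`, from bounds for its tails. -/
theorem exists_tendsto_of_tails {α a M : ℝ} (hα : 0 < α) (ha : 0 < a) {Φ Φ₁ v v₁ : ℝ → ℂ}
    (hΦ : ∀ s, HasDerivAt Φ (Φ₁ s) s) (hΦ₁ : Continuous Φ₁)
    (hv : ∀ s, 1 ≤ s → v s = ((s ^ (α + a) : ℝ) : ℂ) * Φ s)
    (hv₁ : ∀ s, 1 ≤ s → v₁ s = ((s ^ (α + a) : ℝ) : ℂ) * Φ₁ s +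
      (((α + a) * s ^ (α + a - 1) : ℝ) : ℂ) * Φ s)
    (hM : ∀ s, 1 ≤ s → ‖v s‖ ≤ M) :
    ∃ C, 0 ≤ C ∧ ∀ (l B : ℝ),
      (∃ L, Tendsto (fun T : ℝ => ∫ s in (1 : ℝ)..T, Complex.exp (Complex.I * ((l * s : ℝ) : ℂ)) *
        (((s ^ (-a) : ℝ) : ℂ) * v s)) atTop (𝓝 L) ∧ ‖L‖ ≤ B) →
      (∃ L, Tendsto (fun T : ℝ => ∫ s in (1 : ℝ)..T, Complex.exp (Complex.I * ((l * s : ℝ) : ℂ)) *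
        (((s ^ (-a) : ℝ) : ℂ) * v₁ s)) atTop (𝓝 L) ∧ ‖L‖ ≤ B) →
      ∃ L, Tendsto (fun T : ℝ => ∫ s in (0 : ℝ)..T, Complex.exp (Complex.I * ((l * s : ℝ) : ℂ)) *
        (((s ^ α : ℝ) : ℂ) * Φ s)) atTop (𝓝 L) ∧ ‖L‖ ≤ B + C ∧ |l| * ‖L‖ ≤ B + C := by
  have hM0 : 0 ≤ M := (norm_nonneg _).trans (hM 1 le_rfl)
  have hΦc : Continuous Φ := continuous_iff_continuousAt.2 fun s => (hΦ s).continuousAt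
  have hαc : Continuous fun s : ℝ => s ^ α := Real.continuous_rpow_const hα.le
  let g : ℝ → ℂ := fun s => ((s ^ α : ℝ) : ℂ) * Φ s
  let g' : ℝ → ℂ := fun s => ((α * s ^ (α - 1) : ℝ) : ℂ) * Φ s + ((s ^ α : ℝ) : ℂ) * Φ₁ s
  have hgc : Continuous g := by fun_prop
  have hg : ∀ s, 0 < s → HasDerivAt g (g' s) s := fun s hs =>
    ((Real.hasDerivAt_rpow_const (x := s) (p := α) (Or.inl hs.ne')).ofReal_comp).mul (hΦ s)
  -- `g'` may blow up like `s^(α-1)` at the origin, which is integrable because `α > 0`.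
  have hg'i : ∀ b c : ℝ, IntervalIntegrable g' volume b c := by
    intro b c
    refine IntervalIntegrable.add ?_ ?_
    · have h1 : IntervalIntegrable (fun s : ℝ => α * s ^ (α - 1)) volume b c :=
        (intervalIntegral.intervalIntegrable_rpow' (by linarith)).const_mul _
      have h2 : IntervalIntegrable (fun s : ℝ => ((α * s ^ (α - 1) : ℝ) : ℂ)) volume b c :=
        ⟨Integrable.ofReal h1.1, Integrable.ofReal h1.2⟩
      exact h2.mul_continuousOn hΦc.continuousOn
    · exact Continuous.intervalIntegrable (by fun_prop) _ _
  have hvg : ∀ s, 1 ≤ s → ((s ^ (-a) : ℝ) : ℂ) * v s = g s := fun s hs => by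
    have hs0 : 0 < s := by linarith
    rw [hv s hs, ← mul_assoc, ← Complex.ofReal_mul, ← Real.rpow_add hs0]
    simp only [g]
    congr 4
    ring
  -- The product rule for `g = s^(-a) v`; the second term decays like `s^(-a-1)` and is absolutely
  -- integrable.
  have hvg' : ∀ s, 1 ≤ s → g' s = ((s ^ (-a) : ℝ) : ℂ) * v₁ s -
      a * (((s ^ (-(a + 1)) : ℝ) : ℂ) * v s) := fun s hs => by
    have hs0 : 0 < s := by linarith
    have e1 : ((s ^ (-a) : ℝ) : ℂ) * ((s ^ (α + a) : ℝ) : ℂ) = ((s ^ α : ℝ) : ℂ) := by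
      rw [← Complex.ofReal_mul, ← Real.rpow_add hs0]; congr 2; ring
    have e2 : ((s ^ (-a) : ℝ) : ℂ) * ((s ^ (α + a - 1) : ℝ) : ℂ) = ((s ^ (α - 1) : ℝ) : ℂ) := by
      rw [← Complex.ofReal_mul, ← Real.rpow_add hs0]; congr 2; ring
    have e3 : ((s ^ (-(a + 1)) : ℝ) : ℂ) * ((s ^ (α + a) : ℝ) : ℂ) = ((s ^ (α - 1) : ℝ) : ℂ) := by
      rw [← Complex.ofReal_mul, ← Real.rpow_add hs0]; congr 2; ring
    rw [hv s hs, hv₁ s hs]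
    simp only [g', Complex.ofReal_mul, Complex.ofReal_add]
    linear_combination (-Φ₁ s) * e1 - ((α : ℂ) + a) * Φ s * e2 + a * Φ s * e3
  have hvc : ContinuousOn v (Ici 1) := by
    have h1 : ContinuousOn (fun s : ℝ => ((s ^ (α + a) : ℝ) : ℂ) * Φ s) (Ici 1) := by
      have := continuousOn_rpow_Ici_one (α + a)
      fun_prop
    exact h1.congr fun s hs => hv s hs
  have hv₁c : ContinuousOn v₁ (Ici 1) := by
    have h1 : ContinuousOn (fun s : ℝ => ((s ^ (α + a) : ℝ) : ℂ) * Φ₁ s +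
      (((α + a) * s ^ (α + a - 1) : ℝ) : ℂ) * Φ s) (Ici 1) := by
      have := continuousOn_rpow_Ici_one (α + a)
      have := continuousOn_rpow_Ici_one (α + a - 1)
      fun_prop
    exact h1.congr fun s hs => hv₁ s hs
  set C₀ : ℝ := ∫ s in (0 : ℝ)..1, ‖g s‖
  set C₁ : ℝ := ∫ s in (0 : ℝ)..1, ‖g' s‖
  have hC₀ : 0 ≤ C₀ := intervalIntegral.integral_nonneg zero_le_one fun s _ => norm_nonneg _
  have hC₁ : 0 ≤ C₁ := intervalIntegral.integral_nonneg zero_le_one fun s _ => norm_nonneg _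
  -- `C₀` and `C₁` cover `[0, 1]` for `g` and `g'`; `M` covers `a L₃`, since `‖L₃‖ ≤ M / a`.
  refine ⟨C₀ + C₁ + M, by positivity, fun l B => ?_⟩
  rintro ⟨L₁, ht₁, hn₁⟩ ⟨L₂, ht₂, hn₂⟩
  let e : ℝ → ℂ := fun s => Complex.exp (Complex.I * ((l * s : ℝ) : ℂ))
  have hec : Continuous e := by fun_prop
  have hen : ∀ s, ‖e s‖ = 1 := fun s => Complex.norm_exp_I_mul_ofReal _
  have hsub : ∀ {T : ℝ}, 1 ≤ T → uIcc 1 T ⊆ Ici 1 := fun {T} hT => by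
    rw [uIcc_of_le hT]; exact Icc_subset_Ici_self
  have hlim : Tendsto (fun T : ℝ => ∫ s in (0 : ℝ)..T, e s * g s) atTop
      (𝓝 ((∫ s in (0 : ℝ)..1, e s * g s) + L₁)) := by
    refine (ht₁.const_add (∫ s in (0 : ℝ)..1, e s * g s)).congr' ?_
    filter_upwards [eventually_ge_atTop 1] with T hT
    have hegc : Continuous fun s => e s * g s := hec.mul hgc
    rw [← intervalIntegral.integral_add_adjacent_intervals (a := 0) (b := 1) (c := T)
      (hegc.intervalIntegrable _ _) (hegc.intervalIntegrable _ _)]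
    congr 1
    exact intervalIntegral.integral_congr fun s hs => by simp only [hvg s (hsub hT hs)]; rfl
  refine ⟨_, hlim, ?_, ?_⟩
  · have h1 : ‖∫ s in (0 : ℝ)..1, e s * g s‖ ≤ C₀ := by
      refine (intervalIntegral.norm_integral_le_integral_norm zero_le_one).trans (le_of_eq ?_)
      simp only [norm_mul, hen, one_mul, C₀]
    refine (norm_add_le _ _).trans ?_
    linarith
  · obtain ⟨L₃, ht₃, hn₃⟩ := exists_tendsto_of_one_lt (a := a + 1) (by linarith) le_rfl hvc hM l
    rw [Real.one_rpow, add_sub_cancel_right] at hn₃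
    set I₁ : ℂ := ∫ s in (0 : ℝ)..1, e s * g' s
    have hI₁ : ‖I₁‖ ≤ C₁ := by
      refine (intervalIntegral.norm_integral_le_integral_norm zero_le_one).trans (le_of_eq ?_)
      simp only [norm_mul, hen, one_mul, C₁]
    have hlim' : Tendsto (fun T : ℝ => ∫ s in (0 : ℝ)..T, e s * g' s) atTop
        (𝓝 (I₁ + (L₂ - a * L₃))) := by
      refine ((ht₂.sub (ht₃.const_mul (a : ℂ))).const_add I₁).congr' ?_
      filter_upwards [eventually_ge_atTop 1] with T hT
      rw [← intervalIntegral.integral_add_adjacent_intervals (a := 0) (b := 1) (c := T)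
        ((hg'i _ _).continuousOn_mul hec.continuousOn)
        ((hg'i _ _).continuousOn_mul hec.continuousOn)]
      congr 1
      have hr := continuousOn_rpow_Ici_one (-a)
      have hr' := continuousOn_rpow_Ici_one (-(a + 1))
      have c1 : ContinuousOn (fun s : ℝ => Complex.exp (Complex.I * ((l * s : ℝ) : ℂ)) *
        (((s ^ (-a) : ℝ) : ℂ) * v₁ s)) (Ici 1) := by fun_prop
      have c2 : ContinuousOn (fun s : ℝ => a * (Complex.exp (Complex.I * ((l * s : ℝ) : ℂ)) *
        (((s ^ (-(a + 1)) : ℝ) : ℂ) * v s))) (Ici 1) := by fun_prop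
      rw [← intervalIntegral.integral_const_mul,
        ← intervalIntegral.integral_sub (c1.mono (hsub hT)).intervalIntegrable
        (c2.mono (hsub hT)).intervalIntegrable]
      refine intervalIntegral.integral_congr fun s hs => ?_
      simp only [hvg' s (hsub hT hs), e]
      ring
    -- Both boundary terms disappear in the limit: at `0` because `α > 0`, at infinity because `a >
    -- 0`. Keeping `I l` on the left avoids dividing by `l`.
    have hparts : ∀ T, 0 ≤ T → Complex.I * l * ∫ s in (0 : ℝ)..T, e s * g s =
        e T * g T - ∫ s in (0 : ℝ)..T, e s * g' s := by
      intro T hT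
      have he : ∀ s, HasDerivAt e (e s * (Complex.I * l)) s := by
        intro s
        have h1 : HasDerivAt (fun h : ℝ => Complex.I * ((l * h : ℝ) : ℂ)) (Complex.I * l) s := by
          have := ((hasDerivAt_id s).const_mul l).ofReal_comp.const_mul Complex.I
          simpa using this
        exact h1.cexp
      have := intervalIntegral.integral_mul_deriv_eq_deriv_mul_of_hasDerivAt (a := 0) (b := T)
        (u := g) (v := e) (u' := g') (v' := fun s => e s * (Complex.I * l))
        hgc.continuousOn hec.continuousOn
        (fun s hs => hg s (by rw [min_eq_left hT] at hs; exact hs.1)) (fun s _ => he s)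
        (hg'i _ _) ((hec.mul continuous_const).intervalIntegrable _ _)
      have hg0 : g 0 = 0 := by simp [g, hα.ne']
      rw [hg0, zero_mul, sub_zero] at this
      rw [← intervalIntegral.integral_const_mul]
      calc _ = ∫ s in (0 : ℝ)..T, g s * (e s * (Complex.I * l)) := by
            congr 1; ext s; ring
        _ = g T * e T - ∫ s in (0 : ℝ)..T, g' s * e s := this
        _ = _ := by simp only [mul_comm]
    have hlim0 : Tendsto (fun T => e T * g T) atTop (𝓝 0) := by
      have h1 : Tendsto (fun T : ℝ => T ^ (-a) * M) atTop (𝓝 0) := by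
        simpa using (tendsto_rpow_neg_atTop ha).mul_const M
      refine squeeze_zero_norm' ?_ h1
      filter_upwards [eventually_ge_atTop 1] with T hT
      rw [← hvg T hT, norm_exp_mul_rpow_mul hT]
      gcongr
      exact hM T hT
    have hlim2 : Tendsto (fun T : ℝ => Complex.I * l * ∫ s in (0 : ℝ)..T, e s * g s) atTop
        (𝓝 (0 - (I₁ + (L₂ - a * L₃)))) := by
      refine (hlim0.sub hlim').congr' ?_
      filter_upwards [eventually_ge_atTop 0] with T hT
      exact (hparts T hT).symm
    have heq := tendsto_nhds_unique (hlim.const_mul (Complex.I * (l : ℂ))) hlim2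
    have hnorm := congrArg norm heq
    rw [norm_mul, norm_mul, Complex.norm_I, one_mul, Complex.norm_real, Real.norm_eq_abs, zero_sub,
      norm_neg] at hnorm
    rw [hnorm]
    have h5 : ‖(a : ℂ) * L₃‖ ≤ M := by
      rw [norm_mul, Complex.norm_real, Real.norm_of_nonneg ha.le]
      calc a * ‖L₃‖ ≤ a * (M * (1 / a)) := by gcongr
        _ = M := by field_simp
    have h6 := norm_sub_le L₂ ((a : ℂ) * L₃)
    have h7 := norm_add_le I₁ (L₂ - (a : ℂ) * L₃)
    linarith

end Oscillatory

/-! ### From the radial equation to the kernel estimates -/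

/-- The Liouville substitution `v = s^m Φ` removes the first order term of the radial Helmholtz
equation. -/
theorem hasDerivAt_rpow_mul_of_helmholtz {m : ℝ} {Φ Φ₁ Φ₂ : ℝ → ℂ}
    (hΦ : ∀ s, HasDerivAt Φ (Φ₁ s) s) (hΦ₁ : ∀ s, HasDerivAt Φ₁ (Φ₂ s) s) {s : ℝ} (hs : 0 < s)
    (hode : s * Φ₂ s + 2 * m * Φ₁ s + s * Φ s = 0) :
    HasDerivAt (fun s : ℝ => ((s ^ m : ℝ) : ℂ) * Φ s)
      (((s ^ m : ℝ) : ℂ) * Φ₁ s + ((m * s ^ (m - 1) : ℝ) : ℂ) * Φ s) s ∧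
    HasDerivAt (fun s : ℝ => ((s ^ m : ℝ) : ℂ) * Φ₁ s + ((m * s ^ (m - 1) : ℝ) : ℂ) * Φ s)
      (-(((s ^ m : ℝ) : ℂ) * Φ s) + (m * (m - 1) / s ^ 2 : ℝ) • (((s ^ m : ℝ) : ℂ) * Φ s)) s := by
  have h1 := (Real.hasDerivAt_rpow_const (x := s) (p := m) (Or.inl hs.ne')).ofReal_comp
  have h2 := ((Real.hasDerivAt_rpow_const (x := s) (p := m - 1) (Or.inl hs.ne')).const_mul
    m).ofReal_comp
  refine ⟨(h1.mul (hΦ s)).congr_deriv (by ring), ?_⟩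
  refine ((h1.mul (hΦ₁ s)).add (h2.mul (hΦ s))).congr_deriv ?_
  have hsc : (s : ℂ) ≠ 0 := by exact_mod_cast hs.ne'
  rw [Complex.real_smul, Real.rpow_sub_one hs.ne' (m - 1), Real.rpow_sub_one hs.ne' m]
  push_cast
  field_simp
  linear_combination (s : ℂ) * ((s ^ m : ℝ) : ℂ) * hode

/-- Bounds for the wave kernel, from bounds for the tails of one-dimensional oscillatory integrals
of a function satisfying a Schrödinger equation with inverse square potential. -/
theorem exists_waveKernel_bound {n : ℕ} (hn : 2 ≤ n) {γ : ℝ} (hγ : ((n : ℝ) - 1) / 2 < γ)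
    (hγ' : γ < (n : ℝ) - 1) :
    ∃ (k : ℝ) (v v₁ : ℝ → ℂ) (C : ℝ), 0 ≤ C ∧ (∀ s, 1 ≤ s → HasDerivAt v (v₁ s) s) ∧
      (∀ s, 1 ≤ s → HasDerivAt v₁ (-(v s) + (k / s ^ 2 : ℝ) • v s) s) ∧
      ∀ (x : EuclideanSpace ℝ (Fin n)) (t B : ℝ), x ≠ 0 →
      (∃ L, Tendsto (fun T : ℝ => ∫ s in (1 : ℝ)..T,
        Complex.exp (Complex.I * ((t / ‖x‖ * s : ℝ) : ℂ)) *
        (((s ^ (-(γ - ((n : ℝ) - 1) / 2)) : ℝ) : ℂ) * v s)) atTop (𝓝 L) ∧ ‖L‖ ≤ B) →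
      (∃ L, Tendsto (fun T : ℝ => ∫ s in (1 : ℝ)..T,
        Complex.exp (Complex.I * ((t / ‖x‖ * s : ℝ) : ℂ)) *
        (((s ^ (-(γ - ((n : ℝ) - 1) / 2)) : ℝ) : ℂ) * v₁ s)) atTop (𝓝 L) ∧ ‖L‖ ≤ B) →
      Tendsto (fun R : ℝ => truncatedWaveKernel n γ R x t) atTop (𝓝 (waveKernel n γ x t)) ∧
      ‖waveKernel n γ x t‖ ≤ (B + C) * ‖x‖ ^ (-((n : ℝ) - γ)) ∧
      (t ≠ 0 → ‖waveKernel n γ x t‖ ≤ (B + C) * (|t|⁻¹ * ‖x‖ ^ (-((n : ℝ) - 1 - γ)))) := by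
  have : Nonempty (Fin n) := ⟨⟨0, by omega⟩⟩
  obtain ⟨Φ, Φ₁, Φ₂, hΦ, hΦ₁, hode, hrad⟩ := exists_radial_profile
    (E := EuclideanSpace ℝ (Fin n)) (by simp; omega)
  rw [finrank_euclideanSpace_fin] at hode
  set m : ℝ := ((n : ℝ) - 1) / 2 with hm
  -- That is, `α + a = m`: the decay exponent `a` is exactly what makes `s^α Φ = s^(-a) v`.
  have hma : (n : ℝ) - 1 - γ + (γ - m) = m := by rw [hm]; ring
  have hsol : ∀ s : ℝ, 1 ≤ s → _ := fun s hs =>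
    hasDerivAt_rpow_mul_of_helmholtz (m := m) hΦ hΦ₁ (s := s) (by linarith) (by
      have := hode s (by linarith)
      rw [hm]
      push_cast
      linear_combination this)
  obtain ⟨M, -, hM⟩ := exists_bound_of_inverse_square_potential (fun s hs => (hsol s hs).1)
    (fun s hs => (hsol s hs).2)
  have hΦ₁c : Continuous Φ₁ := continuous_iff_continuousAt.2 fun s => (hΦ₁ s).continuousAt
  obtain ⟨C, hC, hmain⟩ := exists_tendsto_of_tails (α := (n : ℝ) - 1 - γ) (a := γ - m)
    (by linarith) (by linarith) hΦ hΦ₁c (fun s _ => by rw [hma]) (fun s _ => by rw [hma])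
    (fun s hs => (hM s hs).1)
  refine ⟨m * (m - 1), _, _, C, hC, fun s hs => (hsol s hs).1, fun s hs => (hsol s hs).2, ?_⟩
  intro x t B hx h1 h2
  obtain ⟨L, hL, hb, hb'⟩ := hmain (t / ‖x‖) B h1 h2
  have hxp : 0 < ‖x‖ := norm_pos_iff.2 hx
  set c : ℂ := ((2 * (Real.pi : ℂ)) ^ n)⁻¹ with hc
  -- The factor `(2π)⁻ⁿ` is at most `1` and is dropped from the bounds.
  have hcn : ‖c‖ ≤ 1 := by
    rw [hc, norm_inv, norm_pow, norm_mul, Complex.norm_ofNat, Complex.norm_real,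
      Real.norm_of_nonneg Real.pi_pos.le]
    exact inv_le_one_of_one_le₀ (one_le_pow₀ (by linarith [Real.pi_gt_three]))
  set K : ℂ := c * ((‖x‖ ^ (-((n : ℝ) - γ)) : ℝ) * L) with hK
  have hlim : Tendsto (fun R : ℝ => truncatedWaveKernel n γ R x t) atTop (𝓝 K) := by
    have h3 : Tendsto (fun R : ℝ => ‖x‖ * R) atTop atTop := tendsto_id.const_mul_atTop hxp
    refine (((hL.comp h3).const_mul (((‖x‖ ^ (-((n : ℝ) - γ)) : ℝ) : ℂ))).const_mul c).congr' ?_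
    filter_upwards [eventually_ge_atTop 0] with R hR
    exact (truncatedWaveKernel_eq hn hγ' hrad x hx t hR).symm
  have hKw : waveKernel n γ x t = K := hlim.limUnder_eq
  have hKn : ‖K‖ ≤ ‖x‖ ^ (-((n : ℝ) - γ)) * ‖L‖ := by
    rw [hK, norm_mul, norm_mul, Complex.norm_real, Real.norm_of_nonneg (by positivity)]
    exact mul_le_of_le_one_left (by positivity) hcn
  rw [hKw]
  refine ⟨hlim, hKn.trans ?_, fun ht => hKn.trans ?_⟩
  · rw [mul_comm]
    gcongr
  · have htp : 0 < |t| := abs_pos.2 ht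
    rw [abs_div, abs_norm, div_mul_eq_mul_div, div_le_iff₀ hxp] at hb'
    have h4 : ‖L‖ ≤ |t|⁻¹ * ((B + C) * ‖x‖) := by
      rw [inv_mul_eq_div, le_div_iff₀ htp, mul_comm]
      exact hb'
    have h5 : ‖x‖ ^ (-((n : ℝ) - 1 - γ)) = ‖x‖ ^ (-((n : ℝ) - γ)) * ‖x‖ := by
      rw [← Real.rpow_add_one hxp.ne']
      congr 1; ring
    rw [h5]
    calc _ ≤ ‖x‖ ^ (-((n : ℝ) - γ)) * (|t|⁻¹ * ((B + C) * ‖x‖)) := by gcongr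
      _ = _ := by ring

/-- Here `a = γ - (n-1)/2 > 1`, so the tails are bounded uniformly in `t/‖x‖` and the light cone
plays no role. -/
theorem waveKernel_bound_of_gt {n : ℕ} (hn : 2 ≤ n) {γ : ℝ} (hγ : ((n : ℝ) + 1) / 2 < γ)
    (hγ' : γ < (n : ℝ) - 1) :
    ∃ C : ℝ, 0 < C ∧ ∀ (x : EuclideanSpace ℝ (Fin n)) (t : ℝ), x ≠ 0 →
        Tendsto (fun R : ℝ => truncatedWaveKernel n γ R x t) atTop (𝓝 (waveKernel n γ x t)) ∧
        (|t| / 2 ≤ ‖x‖ →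
          ‖waveKernel n γ x t‖ ≤ C * ‖x‖ ^ (-((n : ℝ) - γ))) ∧
        (‖x‖ ≤ |t| / 2 →
          ‖waveKernel n γ x t‖ ≤ C * (|t|⁻¹ * ‖x‖ ^ (-((n : ℝ) - 1 - γ)))) := by
  obtain ⟨k, v, v₁, C, hC, hv, hv₁, hmain⟩ := exists_waveKernel_bound hn (by linarith) hγ'
  obtain ⟨M, hM0, hM⟩ := exists_bound_of_inverse_square_potential hv hv₁
  have ha : 1 < γ - ((n : ℝ) - 1) / 2 := by linarith
  set B : ℝ := M * (1 ^ (1 - (γ - ((n : ℝ) - 1) / 2)) / (γ - ((n : ℝ) - 1) / 2 - 1))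
  have hB : 0 ≤ B := mul_nonneg hM0 (div_nonneg (by simp) (by linarith))
  refine ⟨B + C + 1, by positivity, fun x t hx => ?_⟩
  obtain ⟨h1, h2, h3⟩ := hmain x t B hx
    (exists_tendsto_of_one_lt ha le_rfl (fun s hs => (hv s hs).continuousAt.continuousWithinAt)
      (fun s hs => (hM s hs).1) _)
    (exists_tendsto_of_one_lt ha le_rfl (fun s hs => (hv₁ s hs).continuousAt.continuousWithinAt)
      (fun s hs => (hM s hs).2) _)
  have hxp : 0 < ‖x‖ := norm_pos_iff.2 hx
  refine ⟨h1, fun _ => h2.trans ?_, fun h => (h3 fun ht => ?_).trans ?_⟩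
  · exact mul_le_mul_of_nonneg_right (by linarith) (by positivity)
  · rw [ht, abs_zero, zero_div] at h
    linarith
  · exact mul_le_mul_of_nonneg_right (by linarith) (by positivity)

/-- Here `0 < a < 1` and the tails are bounded by `D d^(a-1) + D`, where `d = ||t|/‖x‖ - 1|` is the
rescaled distance to the light cone. -/
theorem waveKernel_bound_of_lt {n : ℕ} (hn : 2 ≤ n) {γ : ℝ} (hγ : ((n : ℝ) - 1) / 2 < γ)
    (hγ₁ : γ < ((n : ℝ) + 1) / 2) (hγ' : γ < (n : ℝ) - 1) :
    ∃ C : ℝ, 0 < C ∧ ∀ (x : EuclideanSpace ℝ (Fin n)) (t : ℝ), x ≠ 0 → ‖x‖ ≠ |t| →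
        Tendsto (fun R : ℝ => truncatedWaveKernel n γ R x t) atTop (𝓝 (waveKernel n γ x t)) ∧
        (|t| / 2 ≤ ‖x‖ →
          ‖waveKernel n γ x t‖ ≤
            C * (‖x‖ ^ (-(((n : ℝ) - 1) / 2)) * |(‖x‖ - |t|)| ^ (-(((n : ℝ) + 1) / 2 - γ)))) ∧
        (‖x‖ ≤ |t| / 2 →
          ‖waveKernel n γ x t‖ ≤ C * (|t|⁻¹ * ‖x‖ ^ (-((n : ℝ) - 1 - γ)))) := by
  obtain ⟨k, v, v₁, C, hC, hv, hv₁, hmain⟩ := exists_waveKernel_bound hn hγ hγ'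
  set a : ℝ := γ - ((n : ℝ) - 1) / 2 with ha
  have ha1 : a < 1 := by linarith
  obtain ⟨D, hD, htail⟩ := exists_tendsto_of_inverse_square_potential (a := a) (by linarith)
    ha1 hv hv₁
  refine ⟨2 * D + C + 1, by positivity, fun x t hx hxt => ?_⟩
  have hxp : 0 < ‖x‖ := norm_pos_iff.2 hx
  have habs : |t / ‖x‖| = |t| / ‖x‖ := by rw [abs_div, abs_norm]
  have hl : |t / ‖x‖| ≠ 1 := by
    rw [habs, Ne, div_eq_one_iff_eq hxp.ne']
    exact hxt.symm
  obtain ⟨h1, h2⟩ := htail _ hl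
  obtain ⟨h3, h4, h5⟩ := hmain x t _ hx h1 h2
  set d : ℝ := |(|t / ‖x‖| - 1)| with hd
  have hd0 : 0 < d := abs_pos.2 (sub_ne_zero.2 hl)
  have hdx : d = |(‖x‖ - |t|)| / ‖x‖ := by
    rw [hd, habs, abs_sub_comm ‖x‖, div_sub_one hxp.ne', abs_div, abs_norm]
  refine ⟨h3, fun h => h4.trans ?_, fun h => (h5 fun ht => ?_).trans ?_⟩
  -- Near the cone `|t|/‖x‖ ∈ [0, 2]`, so `d^(a-1) ≥ 1` absorbs the constants; undoing the scaling
  -- of `d` gives the stated powers.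
  · have hd1 : d ≤ 1 := by
      have h6 : |t| / ‖x‖ ≤ 2 := by rw [div_le_iff₀ hxp]; linarith
      have h7 : 0 ≤ |t| / ‖x‖ := by positivity
      rw [hd, habs, abs_le]
      constructor <;> linarith
    have hone : 1 ≤ d ^ (a - 1) := Real.one_le_rpow_of_pos_of_le_one_of_nonpos hd0 hd1 (by linarith)
    have h8 : d ^ (a - 1) * ‖x‖ ^ (-((n : ℝ) - γ)) =
        ‖x‖ ^ (-(((n : ℝ) - 1) / 2)) * |(‖x‖ - |t|)| ^ (-(((n : ℝ) + 1) / 2 - γ)) := by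
      have e1 : a - 1 = -(((n : ℝ) + 1) / 2 - γ) := by rw [ha]; ring
      rw [hdx, Real.div_rpow (abs_nonneg _) hxp.le, div_mul_eq_mul_div, mul_div_assoc,
        ← Real.rpow_sub hxp, mul_comm, e1]
      congr 2
      ring
    rw [← h8, ← mul_assoc]
    exact mul_le_mul_of_nonneg_right (by nlinarith) (by positivity)
  · rw [ht, abs_zero, zero_div] at h
    linarith
  -- Here `|t|/‖x‖ ≥ 2`, so `d^(a-1) ≤ 1` and the tail bound is uniform.
  · have hd1 : 1 ≤ d := by
      have h6 : 2 ≤ |t| / ‖x‖ := by rw [le_div_iff₀ hxp]; linarith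
      rw [hd, habs]
      exact le_trans (by linarith) (le_abs_self _)
    have hone : d ^ (a - 1) ≤ 1 := Real.rpow_le_one_of_one_le_of_nonpos hd1 (by linarith)
    exact mul_le_mul_of_nonneg_right (by nlinarith) (by positivity)

theorem proposition3p1 (n : ℕ) (γ : ℝ) :
    -- the range `(n + 1) / 2 < γ < n - 1`
    ((4 ≤ n ∧ ((n : ℝ) + 1) / 2 < γ ∧ γ < (n : ℝ) - 1) →
      ∃ C : ℝ, 0 < C ∧ ∀ (x : EuclideanSpace ℝ (Fin n)) (t : ℝ), x ≠ 0 →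
        Tendsto (fun R : ℝ => truncatedWaveKernel n γ R x t) atTop (𝓝 (waveKernel n γ x t)) ∧
        (|t| / 2 ≤ ‖x‖ →
          ‖waveKernel n γ x t‖ ≤ C * ‖x‖ ^ (-((n : ℝ) - γ))) ∧
        (‖x‖ ≤ |t| / 2 →
          ‖waveKernel n γ x t‖ ≤ C * (|t|⁻¹ * ‖x‖ ^ (-((n : ℝ) - 1 - γ))))) ∧
    -- the range `(n - 1) / 2 < γ < (n + 1) / 2`, and `1 / 2 < γ < 1` in dimension two
    (((3 ≤ n ∧ ((n : ℝ) - 1) / 2 < γ ∧ γ < ((n : ℝ) + 1) / 2) ∨ (n = 2 ∧ 1 / 2 < γ ∧ γ < 1)) →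
      ∃ C : ℝ, 0 < C ∧ ∀ (x : EuclideanSpace ℝ (Fin n)) (t : ℝ), x ≠ 0 → ‖x‖ ≠ |t| →
        Tendsto (fun R : ℝ => truncatedWaveKernel n γ R x t) atTop (𝓝 (waveKernel n γ x t)) ∧
        (|t| / 2 ≤ ‖x‖ →
          ‖waveKernel n γ x t‖ ≤
            C * (‖x‖ ^ (-(((n : ℝ) - 1) / 2)) * |(‖x‖ - |t|)| ^ (-(((n : ℝ) + 1) / 2 - γ)))) ∧
        (‖x‖ ≤ |t| / 2 →
          ‖waveKernel n γ x t‖ ≤ C * (|t|⁻¹ * ‖x‖ ^ (-((n : ℝ) - 1 - γ))))) := by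
  refine ⟨fun ⟨hn, h1, h2⟩ => waveKernel_bound_of_gt (by omega) h1 h2, ?_⟩
  rintro (⟨hn, h1, h2⟩ | ⟨rfl, h1, h2⟩)
  -- For `n ≥ 3` one has `(n+1)/2 ≤ n-1`, so `γ < n-1` is automatic; for `n = 2` it is the condition
  -- `γ < 1`.
  · have hn' : (3 : ℝ) ≤ n := by exact_mod_cast hn
    exact waveKernel_bound_of_lt (by omega) h1 h2 (by linarith)
  · exact waveKernel_bound_of_lt le_rfl (by push_cast; linarith) (by push_cast; linarith)
      (by push_cast; linarith)
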